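/- Let $k$ be an associative commutative unital ring and $R$ a unital associative $k$-algebra; all bimodules are $k$-symmetric. Let $A$ be an $R$-ring (a $k$-algebra with a $k$-algebra map $\eta_A:R\to A$, regarded as an $R$-$R$ bimodule through $\eta_A$, with product $\mu_A:A\otimes_R A\to A$), let $C$ be an $R$-coring with coproduct $\Delta$ and counit $\varepsilon$, and let $\psi:C\otimes_R A\to A\otimes_R C$ be a bijective $R$-$R$ bilinear map with $$\psi\circ(C\otimes_R\mu_A)=(\mu_A\otimes_R C)\circ(A\otimes_R\psi)\circ(\psi\otimes_R A),\qquad \psi\circ(C\otimes_R\eta_A)=\eta_A\otimes_R C,$$ $$(A\otimes_R\Delta)\circ\psi=(\psi\otimes_R C)\circ(C\otimes_R\psi)\circ(\Delta\otimes_R A),\qquad (A\otimes_R\varepsilon)\circ\psi=\varepsilon\otimes_R A,$$ i.e. $(A,C,\psi)_R$ is a bijective right entwining structure. Let $e\in C$ be a grouplike element ($\Delta(e)=e\otimes_R e$, $\varepsilon(e)=1_R$). Then $A$ is a right $C$-comodule by $\varrho^A(a)=\psi(e\otimes_R a)$ and a left $C$-comodule by ${}^A\!\varrho(a)=\psi^{-1}(a\otimes_R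 e)$. Let $B=\{b\in A\mid \varrho^A(b)=b\otimes_R e\}$ be the $k$-subalgebra of coinvariants and let $T\subseteq B$ be a $k$-subalgebra. A *strong $T$-connection* is a map $\ell_T:C\to A\otimes_T A$ of left and of right $C$-comodules, where $A\otimes_T A$ has the left coaction ${}^A\!\varrho\otimes_T A$ and the right coaction $A\otimes_T\varrho^A$, such that for all $c\in C$ the map $a\otimes_T a'\mapsto a\,\varrho^A(a')$ sends $\ell_T(c)$ to $1_A\otimes_R c$. A left (resp. right) $C$-comodule $M$ is *$R$-relative injective* if for every map $i:N\to L$ of left (resp. right) $C$-comodules that has a left (resp. right) $R$-linear retraction and every comodule map $f:N\to M$ there is a comodule map $g:L\to M$ with $g\circ i=f$. Suppose that (a) there exists a strong $T$-connection; (b) $A$ is a flat left (resp. right) $T$-module; (c) $B$ is a flat right (resp. left) $T$-module; (d) $B$ is a direct summand of $A$ as a left (resp. right) $T$-module, i.e. the inclusion $B\subseteq A$ has a left (resp. right) $T$-linear retraction. Then $A$, with the coaction ${}^A\!\varrho$ (resp. $\varrho^A$), is $R$-relative injective as a left (resp. right) $C$-comodule. -/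

import Mathlib

universe u v

open MulOpposite

namespace Entw

/-! Tensor products over a not necessarily commutative ring. Right `R`-modules are modules over the
opposite ring `Rᵐᵒᵖ`: the element `m r` is written `op r • m`. -/

section Tensor

/-- The subgroup of the tensor product over the integers generated by the elements
`m r ⊗ n - m ⊗ r n`. -/
def balancedSubgroup (R M N : Type*) [Ring R] [AddCommGroup M] [Module Rᵐᵒᵖ M]
    [AddCommGroup N] [Module R N] : AddSubgroup (TensorProduct ℤ M N) :=
  AddSubgroup.closure
    {x | ∃ (m : M) (r : R) (n : N),
      x = TensorProduct.tmul ℤ (op r • m) n - TensorProduct.tmul ℤ m (r • n)}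

/-- The tensor product of a right `R`-module `M` and a left `R`-module `N`. -/
def BTensor (R M N : Type*) [Ring R] [AddCommGroup M] [Module Rᵐᵒᵖ M]
    [AddCommGroup N] [Module R N] : Type _ :=
  TensorProduct ℤ M N ⧸ balancedSubgroup R M N

notation:70 M:70 "⊠[" R "]" N:71 => BTensor R M N

instance (R M N : Type*) [Ring R] [AddCommGroup M] [Module Rᵐᵒᵖ M]
    [AddCommGroup N] [Module R N] : AddCommGroup (M ⊠[R] N) :=
  inferInstanceAs (AddCommGroup (TensorProduct ℤ M N ⧸ balancedSubgroup R M N))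

/-- The pure tensor `m ⊗ n` in `M ⊗_R N`. -/
def tmul (R : Type*) {M N : Type*} [Ring R] [AddCommGroup M] [Module Rᵐᵒᵖ M]
    [AddCommGroup N] [Module R N] (m : M) (n : N) : M ⊠[R] N :=
  QuotientAddGroup.mk (s := balancedSubgroup R M N) (TensorProduct.tmul ℤ m n)

variable {R S : Type*} [Ring R] [Ring S]
variable {M M' N N' P Q : Type*} [AddCommGroup M] [AddCommGroup M'] [AddCommGroup N]
  [AddCommGroup N'] [AddCommGroup P] [AddCommGroup Q]

section Basic

variable [Module Rᵐᵒᵖ M] [Module Rᵐᵒᵖ M'] [Module R N] [Module R N']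

theorem add_tmul (m m' : M) (n : N) : tmul R (m + m') n = tmul R m n + tmul R m' n :=
  congrArg (QuotientAddGroup.mk (s := balancedSubgroup R M N)) (TensorProduct.add_tmul m m' n)

theorem tmul_add (m : M) (n n' : N) : tmul R m (n + n') = tmul R m n + tmul R m n' :=
  congrArg (QuotientAddGroup.mk (s := balancedSubgroup R M N)) (TensorProduct.tmul_add m n n')

theorem op_smul_tmul (m : M) (r : R) (n : N) : tmul R (op r • m) n = tmul R m (r • n) := by
  refine (QuotientAddGroup.eq_iff_sub_mem (N := balancedSubgroup R M N)).2 ?_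
  exact AddSubgroup.subset_closure ⟨m, r, n, rfl⟩

/-- The additive map on `M ⊗_R N` given by an `R`-balanced biadditive map. -/
def lift (f : M → N → P) (h₁ : ∀ m m' n, f (m + m') n = f m n + f m' n)
    (h₂ : ∀ m n n', f m (n + n') = f m n + f m n')
    (h₃ : ∀ (m : M) (r : R) (n : N), f (op r • m) n = f m (r • n)) : M ⊠[R] N →+ P :=
  QuotientAddGroup.lift (balancedSubgroup R M N)
    (TensorProduct.liftAddHom (AddMonoidHom.mk' (fun m => AddMonoidHom.mk' (f m) (h₂ m))
      (fun m m' => AddMonoidHom.ext (h₁ m m'))) (fun r m n => by rw [map_zsmul, map_zsmul]; rfl))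
    (by
      refine (AddSubgroup.closure_le _).2 ?_
      rintro _ ⟨m, r, n, rfl⟩
      simp [h₃])

@[simp] theorem lift_tmul (f : M → N → P) (h₁ h₂)
    (h₃ : ∀ (m : M) (r : R) (n : N), f (op r • m) n = f m (r • n)) (m : M) (n : N) :
    lift f h₁ h₂ h₃ (tmul R m n) = f m n := rfl

@[simp] theorem zero_tmul (n : N) : tmul R (0 : M) n = 0 :=
  congrArg (QuotientAddGroup.mk (s := balancedSubgroup R M N)) (TensorProduct.zero_tmul M n)

@[simp] theorem tmul_zero (m : M) : tmul R m (0 : N) = 0 :=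
  congrArg (QuotientAddGroup.mk (s := balancedSubgroup R M N)) (TensorProduct.tmul_zero N m)

theorem tensor_induction {p : M ⊠[R] N → Prop} (x : M ⊠[R] N) (zero : p 0)
    (pure : ∀ m n, p (tmul R m n)) (add : ∀ x y, p x → p y → p (x + y)) : p x := by
  obtain ⟨y, rfl⟩ := QuotientAddGroup.mk_surjective x
  induction y with
  | zero => exact zero
  | tmul m n => exact pure m n
  | add a b ha hb => exact add _ _ ha hb

/-- Additive maps out of `M ⊗_R N` agree as soon as they agree on pure tensors. -/
theorem tensor_hom_ext {f g : M ⊠[R] N →+ P} (h : ∀ m n, f (tmul R m n) = g (tmul R m n))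
    (x : M ⊠[R] N) : f x = g x := by
  induction x using tensor_induction with
  | zero => simp
  | pure m n => exact h m n
  | add x y hx hy => simp [hx, hy]

/-- The map `f ⊗ g : M ⊗_R N → M' ⊗_R N'`. -/
def map (f : M →ₗ[Rᵐᵒᵖ] M') (g : N →ₗ[R] N') : M ⊠[R] N →+ M' ⊠[R] N' :=
  lift (fun m n => tmul R (f m) (g n)) (fun m m' n => by rw [map_add, add_tmul])
    (fun m n n' => by rw [map_add, tmul_add])
    (fun m r n => by rw [map_smul, map_smul, op_smul_tmul])

@[simp] theorem map_tmul (f : M →ₗ[Rᵐᵒᵖ] M') (g : N →ₗ[R] N') (m : M) (n : N) :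
    map f g (tmul R m n) = tmul R (f m) (g n) := rfl

end Basic

/-- The left `S`-module structure on `M ⊗_R N`, for an `S`-`R` bimodule `M`. -/
instance (priority := 900) leftModule [Module S M] [Module Rᵐᵒᵖ M] [SMulCommClass S Rᵐᵒᵖ M]
    [Module R N] : Module S (M ⊠[R] N) where
  smul s x := map (DistribSMul.toLinearMap Rᵐᵒᵖ M s) LinearMap.id x
  one_smul := tensor_hom_ext (f := map (DistribSMul.toLinearMap Rᵐᵒᵖ M (1 : S)) LinearMap.id)
    (g := .id _) (by simp)
  mul_smul s t := tensor_hom_ext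
    (f := map (DistribSMul.toLinearMap Rᵐᵒᵖ M (s * t)) LinearMap.id)
    (g := (map (DistribSMul.toLinearMap Rᵐᵒᵖ M s) LinearMap.id).comp
      (map (DistribSMul.toLinearMap Rᵐᵒᵖ M t) LinearMap.id)) (by simp [mul_smul])
  smul_zero s := map_zero _
  smul_add s := map_add _
  add_smul s t := tensor_hom_ext
    (f := map (DistribSMul.toLinearMap Rᵐᵒᵖ M (s + t)) LinearMap.id)
    (g := map (DistribSMul.toLinearMap Rᵐᵒᵖ M s) LinearMap.id +
      map (DistribSMul.toLinearMap Rᵐᵒᵖ M t) LinearMap.id) (by simp [add_smul, add_tmul])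
  zero_smul := tensor_hom_ext (f := map (DistribSMul.toLinearMap Rᵐᵒᵖ M (0 : S)) LinearMap.id)
    (g := 0) (by simp)

/-- The right `S`-module structure on `M ⊗_R N`, for an `R`-`S` bimodule `N`. -/
instance rightModule [Module Rᵐᵒᵖ M] [Module R N] [Module Sᵐᵒᵖ N] [SMulCommClass R Sᵐᵒᵖ N] :
    Module Sᵐᵒᵖ (M ⊠[R] N) :=
  haveI : SMulCommClass Sᵐᵒᵖ R N := SMulCommClass.symm _ _ _
  { smul := fun s x => map LinearMap.id (DistribSMul.toLinearMap R N s) x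
    one_smul := tensor_hom_ext (f := map LinearMap.id (DistribSMul.toLinearMap R N (1 : Sᵐᵒᵖ)))
      (g := .id _) (by simp)
    mul_smul := fun s t => tensor_hom_ext
      (f := map LinearMap.id (DistribSMul.toLinearMap R N (s * t)))
      (g := (map LinearMap.id (DistribSMul.toLinearMap R N s)).comp
        (map LinearMap.id (DistribSMul.toLinearMap R N t))) (by simp [mul_smul])
    smul_zero := fun s => map_zero _
    smul_add := fun s => map_add _
    add_smul := fun s t => tensor_hom_ext
      (f := map LinearMap.id (DistribSMul.toLinearMap R N (s + t)))
      (g := map LinearMap.id (DistribSMul.toLinearMap R N s) +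
        map LinearMap.id (DistribSMul.toLinearMap R N t)) (by simp [add_smul, tmul_add])
    zero_smul := tensor_hom_ext
      (f := map LinearMap.id (DistribSMul.toLinearMap R N (0 : Sᵐᵒᵖ)))
      (g := 0) (by simp) }

@[simp] theorem smul_tmul [Module S M] [Module Rᵐᵒᵖ M] [SMulCommClass S Rᵐᵒᵖ M] [Module R N]
    (s : S) (m : M) (n : N) : s • tmul R m n = tmul R (s • m) n := rfl

@[simp] theorem tmul_op_smul [Module Rᵐᵒᵖ M] [Module R N] [Module Sᵐᵒᵖ N]
    [SMulCommClass R Sᵐᵒᵖ N] (s : Sᵐᵒᵖ) (m : M) (n : N) :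
    s • tmul R m n = tmul R m (s • n) := rfl

instance {S' : Type*} [Ring S'] [Module S M] [Module Rᵐᵒᵖ M] [SMulCommClass S Rᵐᵒᵖ M]
    [Module R N] [Module S'ᵐᵒᵖ N] [SMulCommClass R S'ᵐᵒᵖ N] :
    SMulCommClass S S'ᵐᵒᵖ (M ⊠[R] N) where
  smul_comm s t := tensor_hom_ext
    (f := (DistribSMul.toAddMonoidHom (M ⊠[R] N) s).comp
      (DistribSMul.toAddMonoidHom (M ⊠[R] N) t))
    (g := (DistribSMul.toAddMonoidHom (M ⊠[R] N) t).comp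
      (DistribSMul.toAddMonoidHom (M ⊠[R] N) s)) (fun _ _ => rfl)

section Assoc

variable [Module Rᵐᵒᵖ M] [Module R N] [Module Sᵐᵒᵖ N] [SMulCommClass R Sᵐᵒᵖ N] [Module S P]

/-- The associativity map `(m ⊗ n) ⊗ p ↦ m ⊗ (n ⊗ p)`. -/
def assocHom (R S M N P : Type*) [Ring R] [Ring S] [AddCommGroup M] [AddCommGroup N]
    [AddCommGroup P] [Module Rᵐᵒᵖ M] [Module R N] [Module Sᵐᵒᵖ N] [SMulCommClass R Sᵐᵒᵖ N]
    [Module S P] : (M ⊠[R] N) ⊠[S] P →+ M ⊠[R] (N ⊠[S] P) :=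
  lift (fun x p => lift (fun m n => tmul R m (tmul S n p))
      (fun m m' n => add_tmul _ _ _) (fun m n n' => by rw [add_tmul, tmul_add])
      (fun m r n => by rw [op_smul_tmul, smul_tmul]) x)
    (fun x y p => map_add _ x y)
    (fun x p p' => by
      induction x using tensor_induction with
      | zero => simp only [map_zero, add_zero]
      | pure m n => simp only [lift_tmul, tmul_add]
      | add x y hx hy => simp only [map_add, hx, hy]; abel)
    (fun x s p => by
      induction x using tensor_induction with
      | zero => simp only [smul_zero, map_zero]
      | pure m n => simp only [tmul_op_smul, lift_tmul, op_smul_tmul]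
      | add x y hx hy => simp only [smul_add, map_add, hx, hy])

/-- The associativity map `m ⊗ (n ⊗ p) ↦ (m ⊗ n) ⊗ p`. -/
def assocInvHom (R S M N P : Type*) [Ring R] [Ring S] [AddCommGroup M] [AddCommGroup N]
    [AddCommGroup P] [Module Rᵐᵒᵖ M] [Module R N] [Module Sᵐᵒᵖ N] [SMulCommClass R Sᵐᵒᵖ N]
    [Module S P] : M ⊠[R] (N ⊠[S] P) →+ (M ⊠[R] N) ⊠[S] P :=
  lift (fun m y => lift (fun n p => tmul S (tmul R m n) p)
      (fun n n' p => by rw [tmul_add, add_tmul]) (fun n p p' => tmul_add _ _ _)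
      (fun n s p => by rw [← op_smul_tmul, tmul_op_smul]) y)
    (fun m m' y => by
      induction y using tensor_induction with
      | zero => simp only [map_zero, add_zero]
      | pure n p => simp only [lift_tmul, add_tmul]
      | add x y hx hy => simp only [map_add, hx, hy]; abel)
    (fun m x y => map_add _ x y)
    (fun m r y => by
      induction y using tensor_induction with
      | zero => simp only [smul_zero, map_zero]
      | pure n p => simp only [smul_tmul, lift_tmul, op_smul_tmul]
      | add x y hx hy => simp only [smul_add, map_add, hx, hy])

/-- The associativity isomorphism `(M ⊗_R N) ⊗_S P ≃ M ⊗_R (N ⊗_S P)`. -/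
def assoc (R S M N P : Type*) [Ring R] [Ring S] [AddCommGroup M] [AddCommGroup N]
    [AddCommGroup P] [Module Rᵐᵒᵖ M] [Module R N] [Module Sᵐᵒᵖ N] [SMulCommClass R Sᵐᵒᵖ N]
    [Module S P] : (M ⊠[R] N) ⊠[S] P ≃+ M ⊠[R] (N ⊠[S] P) where
  toFun := assocHom R S M N P
  invFun := assocInvHom R S M N P
  left_inv x := by
    induction x using tensor_induction with
    | zero => simp
    | pure y p =>
      induction y using tensor_induction with
      | zero => simp
      | pure m n => rfl
      | add x y hx hy => simp only [add_tmul, map_add, hx, hy]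
    | add x y hx hy => simp only [map_add, hx, hy]
  right_inv x := by
    induction x using tensor_induction with
    | zero => simp
    | pure m y =>
      induction y using tensor_induction with
      | zero => simp
      | pure n p => rfl
      | add x y hx hy => simp only [tmul_add, map_add, hx, hy]
    | add x y hx hy => simp only [map_add, hx, hy]
  map_add' := map_add _

@[simp] theorem assoc_tmul (m : M) (n : N) (p : P) :
    assoc R S M N P (tmul S (tmul R m n) p) = tmul R m (tmul S n p) := rfl

@[simp] theorem assoc_symm_tmul (m : M) (n : N) (p : P) :
    (assoc R S M N P).symm (tmul R m (tmul S n p)) = tmul S (tmul R m n) p := rfl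

end Assoc

/-- The map `R ⊗_R N → N`, `r ⊗ n ↦ r n`; more generally `A ⊗_R N → N`, `a ⊗ n ↦ a n`, for a left
`A`-module `N` on which the left action of `R` is induced from that of `A`. -/
def act (R A N : Type*) [Ring R] [Ring A] [Module Rᵐᵒᵖ A] [AddCommGroup N] [Module R N]
    [Module A N] (h : ∀ (a : A) (r : R) (n : N), (op r • a) • n = a • r • n) : A ⊠[R] N →+ N :=
  lift (fun a n => a • n) (fun a b n => add_smul a b n) (fun a n n' => smul_add a n n') h

@[simp] theorem act_tmul (A : Type*) [Ring A] [Module Rᵐᵒᵖ A] [Module R N] [Module A N]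
    (h : ∀ (a : A) (r : R) (n : N), (op r • a) • n = a • r • n) (a : A) (n : N) :
    act R A N h (tmul R a n) = a • n := rfl

/-- The unit isomorphism `R ⊗_R N → N`, `r ⊗ n ↦ r n`. -/
def lid (R N : Type*) [Ring R] [AddCommGroup N] [Module R N] : R ⊠[R] N →+ N :=
  act R R N (fun a r n => by simp [mul_smul])

/-- The unit isomorphism `M ⊗_R R → M`, `m ⊗ r ↦ m r`. -/
def rid (R M : Type*) [Ring R] [AddCommGroup M] [Module Rᵐᵒᵖ M] : M ⊠[R] R →+ M :=
  lift (fun m r => op r • m) (fun m m' r => smul_add _ m m')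
    (fun m r s => by rw [op_add, add_smul]) (fun m r s => by rw [smul_eq_mul, op_mul, mul_smul])

@[simp] theorem lid_tmul [Module R N] (r : R) (n : N) : lid R N (tmul R r n) = r • n := rfl

@[simp] theorem rid_tmul [Module Rᵐᵒᵖ M] (m : M) (r : R) : rid R M (tmul R m r) = op r • m := rfl

end Tensor

/-! Bilinear maps, rings over a base ring, and corings. -/

/-- A homomorphism of `R`-`S` bimodules. -/
structure BimodHom (R S M N : Type*) [Ring R] [Ring S] [AddCommGroup M] [AddCommGroup N]
    [Module R M] [Module Sᵐᵒᵖ M] [Module R N] [Module Sᵐᵒᵖ N] extends M →+ N where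
  map_smul' : ∀ (r : R) (m : M), toAddMonoidHom (r • m) = r • toAddMonoidHom m
  map_op_smul' : ∀ (s : S) (m : M), toAddMonoidHom (op s • m) = op s • toAddMonoidHom m

namespace BimodHom

variable {R S M N : Type*} [Ring R] [Ring S] [AddCommGroup M] [AddCommGroup N]
  [Module R M] [Module Sᵐᵒᵖ M] [Module R N] [Module Sᵐᵒᵖ N]

instance : CoeFun (BimodHom R S M N) (fun _ => M → N) := ⟨fun f => f.toAddMonoidHom⟩

/-- The underlying left linear map. -/
def left (f : BimodHom R S M N) : M →ₗ[R] N where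
  toFun := f
  map_add' := f.map_add'
  map_smul' := f.map_smul'

/-- The underlying right linear map. -/
def right (f : BimodHom R S M N) : M →ₗ[Sᵐᵒᵖ] N where
  toFun := f
  map_add' := f.map_add'
  map_smul' s := f.map_op_smul' s.unop

@[simp] theorem left_apply (f : BimodHom R S M N) (m : M) : f.left m = f m := rfl

@[simp] theorem right_apply (f : BimodHom R S M N) (m : M) : f.right m = f m := rfl

end BimodHom

/-- `A` is an `R`-ring: a ring with a ring homomorphism `unit : R → A`, regarded as an
`R`-`R` bimodule through `unit`. -/
class RRing (R A : Type*) [Ring R] [Ring A] [Module R A] [Module Rᵐᵒᵖ A] where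
  unit : R →+* A
  smul_def : ∀ (r : R) (a : A), r • a = unit r * a
  op_smul_def : ∀ (r : R) (a : A), op r • a = a * unit r

instance (A : Type*) [Ring A] : RRing A A where
  unit := RingHom.id A
  smul_def _ _ := rfl
  op_smul_def _ _ := rfl

instance (R S A : Type*) [Ring R] [Ring S] [Ring A] [Module R A] [Module Rᵐᵒᵖ A] [Module S A]
    [Module Sᵐᵒᵖ A] [RRing R A] [RRing S A] : SMulCommClass S Rᵐᵒᵖ A where
  smul_comm s r a := by
    rw [← op_unop r]
    simp only [RRing.smul_def, RRing.op_smul_def, mul_assoc]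

instance (R A : Type*) [Ring R] [Ring A] [Module R A] [Module Rᵐᵒᵖ A] [RRing R A] :
    IsScalarTower R A A where
  smul_assoc r a b := by simp [RRing.smul_def, mul_assoc]

/-- The multiplication `A ⊗_R A → A` as an additive map. -/
def mulAddHom (R A : Type*) [Ring R] [Ring A] [Module R A] [Module Rᵐᵒᵖ A] [RRing R A] :
    A ⊠[R] A →+ A :=
  act R A A (fun a r n => by simp [RRing.smul_def, RRing.op_smul_def, mul_assoc])

/-- The multiplication `A ⊗_R A → A` of an `R`-ring `A`. -/
def mulHom (R A : Type*) [Ring R] [Ring A] [Module R A] [Module Rᵐᵒᵖ A] [RRing R A] :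
    BimodHom R R (A ⊠[R] A) A where
  toAddMonoidHom := mulAddHom R A
  map_smul' r := tensor_hom_ext (f := (mulAddHom R A).comp (DistribSMul.toAddMonoidHom _ r))
    (g := (DistribSMul.toAddMonoidHom _ r).comp (mulAddHom R A))
    (fun a b => smul_mul_assoc r a b)
  map_op_smul' r := tensor_hom_ext
    (f := (mulAddHom R A).comp (DistribSMul.toAddMonoidHom _ (op r)))
    (g := (DistribSMul.toAddMonoidHom _ (op r)).comp (mulAddHom R A))
    (fun a b => by
      change a * (op r • b) = op r • (a * b)
      rw [RRing.op_smul_def, RRing.op_smul_def, mul_assoc])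

@[simp] theorem mulHom_tmul (R A : Type*) [Ring R] [Ring A] [Module R A] [Module Rᵐᵒᵖ A]
    [RRing R A] (a b : A) : mulHom R A (tmul R a b) = a * b := rfl

/-- An `R`-coring structure on an `R`-`R` bimodule `C`. -/
class Coring (R C : Type*) [Ring R] [AddCommGroup C] [Module R C] [Module Rᵐᵒᵖ C]
    [SMulCommClass R Rᵐᵒᵖ C] where
  comul : BimodHom R R C (C ⊠[R] C)
  counit : BimodHom R R C R
  coassoc : ∀ c : C, assoc R R C C C (map comul.right LinearMap.id (comul c)) =
    map LinearMap.id comul.left (comul c)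
  counit_left : ∀ c : C, lid R C (map counit.right LinearMap.id (comul c)) = c
  counit_right : ∀ c : C, rid R C (map LinearMap.id counit.left (comul c)) = c

section Comodules

variable {R C : Type*} [Ring R] [AddCommGroup C] [Module R C] [Module Rᵐᵒᵖ C]
  [SMulCommClass R Rᵐᵒᵖ C] [Coring R C]

/-- A grouplike element of an `R`-coring. -/
structure IsGrouplike (R : Type*) {C : Type*} [Ring R] [AddCommGroup C] [Module R C]
    [Module Rᵐᵒᵖ C] [SMulCommClass R Rᵐᵒᵖ C] [Coring R C] (e : C) : Prop where
  comul_eq : Coring.comul (R := R) e = tmul R e e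
  counit_eq : Coring.counit (R := R) e = 1

/-- `ρ` makes the left `R`-module `M` a left `C`-comodule. -/
structure IsLeftComodule {M : Type*} [AddCommGroup M] [Module R M] (ρ : M →ₗ[R] C ⊠[R] M) :
    Prop where
  coassoc : ∀ m, assoc R R C C M (map (Coring.comul (R := R) (C := C)).right LinearMap.id (ρ m)) =
    map LinearMap.id ρ (ρ m)
  counit : ∀ m, lid R M (map (Coring.counit (R := R) (C := C)).right LinearMap.id (ρ m)) = m

/-- `ρ` makes the right `R`-module `M` a right `C`-comodule. -/
structure IsRightComodule {M : Type*} [AddCommGroup M] [Module Rᵐᵒᵖ M]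
    (ρ : M →ₗ[Rᵐᵒᵖ] M ⊠[R] C) : Prop where
  coassoc : ∀ m, assoc R R M C C (map ρ LinearMap.id (ρ m)) =
    map LinearMap.id (Coring.comul (R := R) (C := C)).left (ρ m)
  counit : ∀ m, rid R M (map LinearMap.id (Coring.counit (R := R) (C := C)).left (ρ m)) = m

/-- The left linear map `f` is a map of left `C`-comodules. -/
def IsLeftColinear {M N : Type*} [AddCommGroup M] [Module R M] [AddCommGroup N] [Module R N]
    (ρM : M →ₗ[R] C ⊠[R] M) (ρN : N →ₗ[R] C ⊠[R] N) (f : M →ₗ[R] N) : Prop :=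
  ∀ m, ρN (f m) = map LinearMap.id f (ρM m)

/-- The right linear map `f` is a map of right `C`-comodules. -/
def IsRightColinear {M N : Type*} [AddCommGroup M] [Module Rᵐᵒᵖ M] [AddCommGroup N]
    [Module Rᵐᵒᵖ N] (ρM : M →ₗ[Rᵐᵒᵖ] M ⊠[R] C) (ρN : N →ₗ[Rᵐᵒᵖ] N ⊠[R] C)
    (f : M →ₗ[Rᵐᵒᵖ] N) : Prop :=
  ∀ m, ρN (f m) = map f LinearMap.id (ρM m)

/-- The left `C`-comodule `M` with coaction `ρ` is `R`-relative injective: comodule maps into `M`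
extend along every comodule map `i : N → L` that has a left `R`-linear retraction. -/
def IsRelInjectiveLeft {M : Type*} [AddCommGroup M] [Module R M] (ρ : M →ₗ[R] C ⊠[R] M) : Prop :=
  IsLeftComodule ρ ∧
    ∀ (N L : Type v) [AddCommGroup N] [Module R N] [AddCommGroup L] [Module R L]
      (ρN : N →ₗ[R] C ⊠[R] N) (ρL : L →ₗ[R] C ⊠[R] L),
      IsLeftComodule ρN → IsLeftComodule ρL →
      ∀ (i : N →ₗ[R] L), IsLeftColinear ρN ρL i → (∃ p : L →ₗ[R] N, ∀ n, p (i n) = n) →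
      ∀ (f : N →ₗ[R] M), IsLeftColinear ρN ρ f →
        ∃ g : L →ₗ[R] M, IsLeftColinear ρL ρ g ∧ ∀ n, g (i n) = f n

/-- The right `C`-comodule `M` with coaction `ρ` is `R`-relative injective: comodule maps into `M`
extend along every comodule map `i : N → L` that has a right `R`-linear retraction. -/
def IsRelInjectiveRight {M : Type*} [AddCommGroup M] [Module Rᵐᵒᵖ M]
    (ρ : M →ₗ[Rᵐᵒᵖ] M ⊠[R] C) : Prop :=
  IsRightComodule ρ ∧
    ∀ (N L : Type v) [AddCommGroup N] [Module Rᵐᵒᵖ N] [AddCommGroup L] [Module Rᵐᵒᵖ L]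
      (ρN : N →ₗ[Rᵐᵒᵖ] N ⊠[R] C) (ρL : L →ₗ[Rᵐᵒᵖ] L ⊠[R] C),
      IsRightComodule ρN → IsRightComodule ρL →
      ∀ (i : N →ₗ[Rᵐᵒᵖ] L), IsRightColinear ρN ρL i →
      (∃ p : L →ₗ[Rᵐᵒᵖ] N, ∀ n, p (i n) = n) →
      ∀ (f : N →ₗ[Rᵐᵒᵖ] M), IsRightColinear ρN ρ f →
        ∃ g : L →ₗ[Rᵐᵒᵖ] M, IsRightColinear ρL ρ g ∧ ∀ n, g (i n) = f n

end Comodules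

/-! Flat modules. -/

/-- The left `T`-module `M` is flat: `- ⊗_T M` preserves injective maps of right `T`-modules. -/
def IsFlatLeft (T M : Type u) [Ring T] [AddCommGroup M] [Module T M] : Prop :=
  ∀ (N N' : Type u) [AddCommGroup N] [Module Tᵐᵒᵖ N] [AddCommGroup N'] [Module Tᵐᵒᵖ N']
    (f : N →ₗ[Tᵐᵒᵖ] N'), Function.Injective f →
      Function.Injective (map f (LinearMap.id : M →ₗ[T] M))

/-- The right `T`-module `M` is flat: `M ⊗_T -` preserves injective maps of left `T`-modules. -/
def IsFlatRight (T M : Type u) [Ring T] [AddCommGroup M] [Module Tᵐᵒᵖ M] : Prop :=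
  ∀ (N N' : Type u) [AddCommGroup N] [Module T N] [AddCommGroup N'] [Module T N']
    (f : N →ₗ[T] N'), Function.Injective f →
      Function.Injective (map (LinearMap.id : M →ₗ[Tᵐᵒᵖ] M) f)

/-! Entwining structures. -/

/-- A bijective right entwining structure `(A, C, ψ)_R`. -/
structure BijEntwining (R A C : Type*) [Ring R] [Ring A] [Module R A] [Module Rᵐᵒᵖ A] [RRing R A]
    [AddCommGroup C] [Module R C] [Module Rᵐᵒᵖ C] [SMulCommClass R Rᵐᵒᵖ C] [Coring R C] where
  ψ : BimodHom R R (C ⊠[R] A) (A ⊠[R] C)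
  /-- `ψ ∘ (C ⊗ μ) = (μ ⊗ C) ∘ (A ⊗ ψ) ∘ (ψ ⊗ A)` -/
  psi_mul : ∀ x : (C ⊠[R] A) ⊠[R] A,
    ψ (map LinearMap.id (mulHom R A).left (assoc R R C A A x)) =
      map (mulHom R A).right LinearMap.id ((assoc R R A A C).symm
        (map LinearMap.id ψ.left (assoc R R A C A (map ψ.right LinearMap.id x))))
  /-- `ψ ∘ (C ⊗ η) = η ⊗ C` -/
  psi_one : ∀ c : C, ψ (tmul R c 1) = tmul R 1 c
  /-- `(A ⊗ Δ) ∘ ψ = (ψ ⊗ C) ∘ (C ⊗ ψ) ∘ (Δ ⊗ A)` -/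
  psi_comul : ∀ x : C ⊠[R] A,
    map LinearMap.id (Coring.comul (R := R) (C := C)).left (ψ x) =
      assoc R R A C C (map ψ.right LinearMap.id ((assoc R R C A C).symm
        (map LinearMap.id ψ.left (assoc R R C C A
          (map (Coring.comul (R := R) (C := C)).right LinearMap.id x)))))
  /-- `(A ⊗ ε) ∘ ψ = ε ⊗ A` -/
  psi_counit : ∀ x : C ⊠[R] A,
    rid R A (map LinearMap.id (Coring.counit (R := R) (C := C)).left (ψ x)) =
      lid R A (map (Coring.counit (R := R) (C := C)).right LinearMap.id x)
  bijective : Function.Bijective ψ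

namespace BijEntwining

variable {R A C : Type*} [Ring R] [Ring A] [Module R A] [Module Rᵐᵒᵖ A] [RRing R A]
  [AddCommGroup C] [Module R C] [Module Rᵐᵒᵖ C] [SMulCommClass R Rᵐᵒᵖ C] [Coring R C]
  (E : BijEntwining R A C) (e : C)

/-- The isomorphism `ψ`, with inverse `ψ⁻¹`. -/
noncomputable def equiv : C ⊠[R] A ≃+ A ⊠[R] C :=
  AddEquiv.ofBijective E.ψ.toAddMonoidHom E.bijective

theorem psi_equiv_symm (x : A ⊠[R] C) : E.ψ (E.equiv.symm x) = x :=
  E.equiv.apply_symm_apply x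

/-- The right coaction `a ↦ ψ (e ⊗ a)` on `A`. -/
def rightCoaction : A →ₗ[Rᵐᵒᵖ] A ⊠[R] C where
  toFun a := E.ψ (tmul R e a)
  map_add' a b := by rw [tmul_add]; exact map_add E.ψ.toAddMonoidHom _ _
  map_smul' r a := E.ψ.map_op_smul' r.unop (tmul R e a)

/-- The left coaction `a ↦ ψ⁻¹ (a ⊗ e)` on `A`. -/
noncomputable def leftCoaction : A →ₗ[R] C ⊠[R] A where
  toFun a := E.equiv.symm (tmul R a e)
  map_add' a b := by rw [add_tmul, map_add]
  map_smul' r a := by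
    rw [RingHom.id_apply, AddEquiv.symm_apply_eq]
    exact ((E.ψ.map_smul' r _).trans (congrArg (r • ·) (E.psi_equiv_symm (tmul R a e)))).symm

theorem rightCoaction_apply (a : A) : E.rightCoaction e a = E.ψ (tmul R e a) := rfl

theorem leftCoaction_apply (a : A) : E.leftCoaction e a = E.equiv.symm (tmul R a e) := rfl

/-- The element `b` is coinvariant: `ϱ(b) = b ⊗ e`. -/
def IsCoinvariant (b : A) : Prop := E.rightCoaction e b = tmul R b e

variable {E e}

theorem IsCoinvariant.rightCoaction_mul {b : A} (hb : E.IsCoinvariant e b) (a : A) :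
    E.rightCoaction e (b * a) = b • E.rightCoaction e a := by
  have h := E.psi_mul (tmul R (tmul R e b) a)
  simp only [assoc_tmul, map_tmul, BimodHom.left_apply, BimodHom.right_apply, mulHom_tmul,
    LinearMap.id_apply] at h
  rw [rightCoaction_apply, h, ← rightCoaction_apply, hb, assoc_tmul, map_tmul]
  simp only [BimodHom.left_apply, LinearMap.id_apply, ← rightCoaction_apply]
  generalize E.rightCoaction e a = y
  induction y using tensor_induction with
  | zero =>
    simp
  | pure a c => simp
  | add x y hx hy => rw [tmul_add, map_add, map_add, hx, hy, smul_add]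

theorem IsCoinvariant.leftCoaction_mul {b : A} (hb : E.IsCoinvariant e b) (a : A) :
    E.leftCoaction e (a * b) = op b • E.leftCoaction e a := by
  have key : ∀ x : C ⊠[R] A, E.ψ (op b • x) =
      map (mulHom R A).right LinearMap.id ((assoc R R A A C).symm
        (map LinearMap.id E.ψ.left (assoc R R A C A (tmul R (E.ψ x) b)))) := by
    intro x
    have h := E.psi_mul (tmul R x b)
    rw [map_tmul] at h
    simp only [BimodHom.right_apply, LinearMap.id_apply] at h
    rw [← h]
    congr 1
    clear h
    induction x using tensor_induction with
    | zero => simp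
    | pure c a => simp
    | add x y hx hy => rw [smul_add, hx, hy, add_tmul, map_add, map_add]
  rw [leftCoaction_apply, AddEquiv.symm_apply_eq]
  refine Eq.trans ?_ (key _).symm
  rw [leftCoaction_apply, psi_equiv_symm]
  simp only [assoc_tmul, map_tmul, BimodHom.left_apply, LinearMap.id_apply]
  rw [← rightCoaction_apply, hb]
  simp

end BijEntwining

/-! Coinvariants and strong connections. -/

section Subalgebra

variable {k : Type*} [CommRing k]

/-- A right `A`-module is a right module over every subalgebra of `A`. -/
instance subalgebraRightModule {A M : Type*} [Ring A] [Algebra k A] [AddCommGroup M]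
    [Module Aᵐᵒᵖ M] (S : Subalgebra k A) : Module (↥S)ᵐᵒᵖ M :=
  Module.compHom M (RingHom.op S.val.toRingHom)

/-- `A` is a `B`-ring for every subalgebra `B` of `A`. -/
instance subalgebraRRing {A : Type*} [Ring A] [Algebra k A] (B : Subalgebra k A) :
    RRing B A where
  unit := B.val.toRingHom
  smul_def _ _ := rfl
  op_smul_def _ _ := rfl

/-- `A` is a `T`-ring for subalgebras `T ⊆ B ⊆ A`. -/
instance subsubalgebraRRing {A : Type*} [Ring A] [Algebra k A] (B : Subalgebra k A)
    (T : Subalgebra k B) : RRing T A where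
  unit := B.val.toRingHom.comp T.val.toRingHom
  smul_def _ _ := rfl
  op_smul_def _ _ := rfl

end Subalgebra

namespace BijEntwining

variable {R A C : Type*} [Ring R] [Ring A] [Module R A] [Module Rᵐᵒᵖ A] [RRing R A]
  [AddCommGroup C] [Module R C] [Module Rᵐᵒᵖ C] [SMulCommClass R Rᵐᵒᵖ C] [Coring R C]
  (E : BijEntwining R A C) (e : C)

/-- The `k`-subalgebra `B = {b | ϱ(b) = b ⊗ e}` of coinvariants in `A`. -/
def coinvariants (k : Type*) [CommRing k] [Algebra k R] [Algebra k A] [IsScalarTower k R A]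
    [Module k C] [IsScalarTower k R C] [IsScalarTower k Rᵐᵒᵖ C] : Subalgebra k A where
  carrier := {b | E.IsCoinvariant e b}
  mul_mem' {a b} ha hb := by
    change E.IsCoinvariant e (a * b)
    rw [IsCoinvariant, ha.rightCoaction_mul, show E.rightCoaction e b = _ from hb]
    simp
  add_mem' {a b} ha hb := by
    change E.IsCoinvariant e (a + b)
    rw [IsCoinvariant, map_add, add_tmul, show E.rightCoaction e a = _ from ha,
      show E.rightCoaction e b = _ from hb]
  algebraMap_mem' x := by
    change E.IsCoinvariant e (algebraMap k A x)
    have h1 : algebraMap k A x = (algebraMap k R x) • (1 : A) := by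
      rw [algebraMap_smul, Algebra.algebraMap_eq_smul_one]
    have h2 : op (algebraMap k R x) • e = (algebraMap k R x) • e := by
      rw [algebraMap_smul, ← algebraMap_smul Rᵐᵒᵖ x e]; rfl
    rw [IsCoinvariant, rightCoaction_apply, h1, ← op_smul_tmul, h2, ← smul_tmul]
    rw [show E.ψ (algebraMap k R x • tmul R e 1) = _ from E.ψ.map_smul' _ _]
    exact congrArg (algebraMap k R x • ·) (E.psi_one e)

section StrongConnection

/- Here `A` is a `T`-ring such that the image of `T` in `A` consists of coinvariants. -/
variable {T : Type*} [Ring T] [Module T A] [Module Tᵐᵒᵖ A] [RRing T A]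
  (hT : ∀ t : T, E.IsCoinvariant e (RRing.unit t : A))

variable {E e}

/-- The right coaction on `A`, as a left `T`-linear map. -/
def rightCoactionT : A →ₗ[T] A ⊠[R] C where
  toFun := E.rightCoaction e
  map_add' := map_add _
  map_smul' t a := by
    rw [RRing.smul_def, (hT t).rightCoaction_mul]
    generalize E.rightCoaction e a = y
    induction y using tensor_induction with
    | zero => simp
    | pure a c => simp [RRing.smul_def]
    | add x y hx hy => rw [smul_add, hx, hy, smul_add]

/-- The left coaction on `A`, as a right `T`-linear map. -/
noncomputable def leftCoactionT : A →ₗ[Tᵐᵒᵖ] C ⊠[R] A where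
  toFun := E.leftCoaction e
  map_add' := map_add _
  map_smul' t a := by
    rw [← op_unop t, RRing.op_smul_def, (hT _).leftCoaction_mul]
    generalize E.leftCoaction e a = y
    induction y using tensor_induction with
    | zero => simp
    | pure c a =>
      rw [tmul_op_smul, tmul_op_smul, RingHom.id_apply, RRing.op_smul_def (unop t) a]
      rfl
    | add x y hx hy => rw [smul_add, hx, hy, smul_add]

/-- The right `C`-coaction `A ⊗_T ϱ` on `A ⊗_T A`. -/
def tensorRightCoaction (x : A ⊠[T] A) : (A ⊠[T] A) ⊠[R] C :=
  (assoc T R A A C).symm (map LinearMap.id (rightCoactionT hT) x)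

/-- The left `C`-coaction `ϱ ⊗_T A` on `A ⊗_T A`. -/
noncomputable def tensorLeftCoaction (x : A ⊠[T] A) : C ⊠[R] (A ⊠[T] A) :=
  assoc R T C A A (map (leftCoactionT hT) LinearMap.id x)

/-- The lifted canonical map `A ⊗_T A → A ⊗_R C`, `a ⊗ a' ↦ a ϱ(a')`. -/
def liftedCan : A ⊠[T] A →+ A ⊠[R] C :=
  (act T A (A ⊠[R] C) (fun a t x => by
    induction x using tensor_induction with
    | zero => simp
    | pure b c => simp [RRing.smul_def, RRing.op_smul_def, mul_assoc]
    | add x y hx hy => rw [smul_add, hx, hy, smul_add, smul_add])).comp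
    (map LinearMap.id (rightCoactionT hT))

/-- `ℓ : C → A ⊗_T A` is a strong `T`-connection. -/
structure IsStrongConnection (ℓ : BimodHom R R C (A ⊠[T] A)) : Prop where
  left_colinear : ∀ c, tensorLeftCoaction hT (ℓ c) =
    map LinearMap.id ℓ.left (Coring.comul (R := R) c)
  right_colinear : ∀ c, tensorRightCoaction hT (ℓ c) =
    map ℓ.right LinearMap.id (Coring.comul (R := R) c)
  can_eq : ∀ c, liftedCan hT (ℓ c) = tmul R 1 c

end StrongConnection

theorem isCoinvariant_unit {k : Type*} [CommRing k] [Algebra k R] [Algebra k A]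
    [IsScalarTower k R A] [Module k C] [IsScalarTower k R C] [IsScalarTower k Rᵐᵒᵖ C]
    (T : Subalgebra k (E.coinvariants e k)) (t : T) : E.IsCoinvariant e (RRing.unit t : A) := by
  change E.IsCoinvariant e ((t : E.coinvariants e k) : A)
  exact (t : E.coinvariants e k).2

/-- For a `k`-subalgebra `T` of the algebra `B` of coinvariants, there exists a strong
`T`-connection. -/
def HasStrongConnection {k : Type*} [CommRing k] [Algebra k R] [Algebra k A] [IsScalarTower k R A]
    [Module k C] [IsScalarTower k R C] [IsScalarTower k Rᵐᵒᵖ C]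
    (T : Subalgebra k (E.coinvariants e k)) : Prop :=
  ∃ ℓ : BimodHom R R C (A ⊠[T] A),
    IsStrongConnection (E := E) (e := e) (T := T) (E.isCoinvariant_unit e T) ℓ

end BijEntwining
end Entw

/-! A comodule is `R`-relative injective as soon as its coaction ϱ has a colinear retraction π out
of the cofree comodule (`IsLeftComodule.isRelInjectiveLeft`). In the left case π is assembled from
the strong connection ℓ: send c ⊗ a to ∑ aᵢ ℓ(cᵢ), where ψ(c ⊗ a) = ∑ aᵢ ⊗ cᵢ, and then x ⊗ y to x
φ(y), for a `T`-linear φ : A → A with values in B that fixes B. The first map is left colinear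
because ℓ is and ψ respects products and Δ
(`IsStrongConnection.tensorLeftCoaction_entwinedTranslationLeft`); the second because ϱ is right
B-linear (`leftCoaction_mulMapLeft`).

Since ϱ(a) = ψ⁻¹(a ⊗ e), the composite π ∘ ϱ multiplies a on the right by the value of x ⊗ y ↦ x
φ(y) at ℓ(e). If ℓ(e) comes from B ⊗_T B, then φ can be dropped, and the product of ℓ(e) is ε(e) = 1
(`IsStrongConnection.mulHom_grouplike`).

Flatness serves to place ℓ(e) in B ⊗_T B (`exists_map_eq_grouplike_left`). This element is
coinvariant on both sides, and B is the kernel of a `T`-linear map on either side. Left flatness of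
A lifts ℓ(e) to B ⊗_T A. Right coinvariance of the lift can be tested in A ⊗_T (A ⊗_R C), provided A
⊗_R C is left flat over T; it is, being a retract of A ⊗_T A through a ⊗ c ↦ a ℓ(c) and the lifted
canonical map. Right flatness of B then lifts the element to B ⊗_T B.

The right case is the mirror image, with ψ⁻¹ and C ⊗_R A in place of ψ and A ⊗_R C. Throughout, B is
an abstract `T`-bimodule with a map j to A whose image is the set of coinvariants. -/

namespace Entw

/-! ### Functoriality of the tensor product and naturality of associativity. -/

section TensorMaps

variable {R S : Type*} [Ring R] [Ring S]
variable {M M' M'' N N' N'' P P' : Type*} [AddCommGroup M] [AddCommGroup M'] [AddCommGroup M'']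
  [AddCommGroup N] [AddCommGroup N'] [AddCommGroup N''] [AddCommGroup P] [AddCommGroup P']

section Functoriality

variable [Module Rᵐᵒᵖ M] [Module Rᵐᵒᵖ M'] [Module Rᵐᵒᵖ M''] [Module R N] [Module R N']
  [Module R N'']

theorem map_map (f' : M' →ₗ[Rᵐᵒᵖ] M'') (g' : N' →ₗ[R] N'') (f : M →ₗ[Rᵐᵒᵖ] M') (g : N →ₗ[R] N')
    (x : M ⊠[R] N) : map f' g' (map f g x) = map (f' ∘ₗ f) (g' ∘ₗ g) x :=
  tensor_hom_ext (f := (map f' g').comp (map f g)) (g := map (f' ∘ₗ f) (g' ∘ₗ g))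
    (fun _ _ => rfl) x

@[simp] theorem map_id_id (x : M ⊠[R] N) :
    map (LinearMap.id : M →ₗ[Rᵐᵒᵖ] M) (LinearMap.id : N →ₗ[R] N) x = x :=
  tensor_hom_ext (f := map LinearMap.id LinearMap.id) (g := .id _) (fun _ _ => rfl) x

theorem sub_tmul (m m' : M) (n : N) : tmul R (m - m') n = tmul R m n - tmul R m' n := by
  rw [eq_sub_iff_add_eq, ← add_tmul, sub_add_cancel]

theorem tmul_sub (m : M) (n n' : N) : tmul R m (n - n') = tmul R m n - tmul R m n' := by
  rw [eq_sub_iff_add_eq, ← tmul_add, sub_add_cancel]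

/-- The map `f ⊗ g` as a left linear map. -/
def mapLeft [Module S M] [SMulCommClass S Rᵐᵒᵖ M] [Module S M'] [SMulCommClass S Rᵐᵒᵖ M']
    (f : M →ₗ[Rᵐᵒᵖ] M') (hf : ∀ (s : S) m, f (s • m) = s • f m) (g : N →ₗ[R] N') :
    M ⊠[R] N →ₗ[S] M' ⊠[R] N' where
  toFun := map f g
  map_add' := map_add _
  map_smul' s := tensor_hom_ext (f := (map f g).comp (DistribSMul.toAddMonoidHom _ s))
    (g := (DistribSMul.toAddMonoidHom _ s).comp (map f g))
    (fun m n => congrArg (tmul R · (g n)) (hf s m))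

@[simp] theorem mapLeft_apply [Module S M] [SMulCommClass S Rᵐᵒᵖ M] [Module S M']
    [SMulCommClass S Rᵐᵒᵖ M'] (f : M →ₗ[Rᵐᵒᵖ] M') (hf : ∀ (s : S) m, f (s • m) = s • f m)
    (g : N →ₗ[R] N') (x : M ⊠[R] N) : mapLeft f hf g x = map f g x := rfl

/-- The map `f ⊗ g` as a right linear map. -/
def mapRight [Module Sᵐᵒᵖ N] [SMulCommClass R Sᵐᵒᵖ N] [Module Sᵐᵒᵖ N'] [SMulCommClass R Sᵐᵒᵖ N']
    (f : M →ₗ[Rᵐᵒᵖ] M') (g : N →ₗ[R] N') (hg : ∀ (s : Sᵐᵒᵖ) n, g (s • n) = s • g n) :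
    M ⊠[R] N →ₗ[Sᵐᵒᵖ] M' ⊠[R] N' where
  toFun := map f g
  map_add' := map_add _
  map_smul' s := tensor_hom_ext (f := (map f g).comp (DistribSMul.toAddMonoidHom _ s))
    (g := (DistribSMul.toAddMonoidHom _ s).comp (map f g))
    (fun m n => congrArg (tmul R (f m)) (hg s n))

@[simp] theorem mapRight_apply [Module Sᵐᵒᵖ N] [SMulCommClass R Sᵐᵒᵖ N] [Module Sᵐᵒᵖ N']
    [SMulCommClass R Sᵐᵒᵖ N'] (f : M →ₗ[Rᵐᵒᵖ] M') (g : N →ₗ[R] N')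
    (hg : ∀ (s : Sᵐᵒᵖ) n, g (s • n) = s • g n) (x : M ⊠[R] N) : mapRight f g hg x = map f g x :=
  rfl

/-- Additive maps out of `(M ⊗_R N) ⊗_S P` agree as soon as they agree on pure tensors. -/
theorem tensor_hom_ext₃ {Q : Type*} [AddCommGroup Q] [Module Sᵐᵒᵖ N] [SMulCommClass R Sᵐᵒᵖ N]
    [Module S P] {f g : (M ⊠[R] N) ⊠[S] P →+ Q}
    (h : ∀ m n p, f (tmul S (tmul R m n) p) = g (tmul S (tmul R m n) p))
    (x : (M ⊠[R] N) ⊠[S] P) : f x = g x := by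
  refine tensor_hom_ext (fun y p => ?_) x
  induction y using tensor_induction with
  | zero => simp
  | pure m n => exact h m n p
  | add y z hy hz => rw [add_tmul, map_add, map_add, hy, hz]

end Functoriality

section Naturality

variable [Module Rᵐᵒᵖ M] [Module Rᵐᵒᵖ M'] [Module R N] [Module Sᵐᵒᵖ N] [SMulCommClass R Sᵐᵒᵖ N]
  [Module R N'] [Module Sᵐᵒᵖ N'] [SMulCommClass R Sᵐᵒᵖ N'] [Module S P] [Module S P']

theorem assoc_map_id_right (f : M →ₗ[Rᵐᵒᵖ] M') (x : (M ⊠[R] N) ⊠[S] P) :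
    assoc R S M' N P (map (mapRight f LinearMap.id (fun _ _ => rfl)) LinearMap.id x) =
      map f LinearMap.id (assoc R S M N P x) :=
  tensor_hom_ext₃
    (f := (assoc R S M' N P).toAddMonoidHom.comp
      (map (mapRight f LinearMap.id (fun _ _ => rfl)) LinearMap.id))
    (g := (map f LinearMap.id).comp (assoc R S M N P).toAddMonoidHom)
    (fun _ _ _ => rfl) x

theorem assoc_map_id_left (h : P →ₗ[S] P') (x : (M ⊠[R] N) ⊠[S] P) :
    assoc R S M N P' (map LinearMap.id h x) =
      map LinearMap.id (mapLeft LinearMap.id (fun _ _ => rfl) h) (assoc R S M N P x) :=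
  tensor_hom_ext₃
    (f := (assoc R S M N P').toAddMonoidHom.comp (map LinearMap.id h))
    (g := (map LinearMap.id (mapLeft LinearMap.id (fun _ _ => rfl) h)).comp
      (assoc R S M N P).toAddMonoidHom)
    (fun _ _ _ => rfl) x

end Naturality

end TensorMaps

/-! ### Right exactness of the tensor product. -/

section Exactness

variable {T : Type*} [Ring T]

/-- The quotient map from M ⊗ N to the cokernel of K ⊗ N → M ⊗ N factors through Q ⊗ N, so whatever
dies in Q ⊗ N dies in the cokernel. -/
theorem exists_map_eq_of_map_eq_zero_left {K M Q N : Type*} [AddCommGroup K] [AddCommGroup M]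
    [AddCommGroup Q] [AddCommGroup N] [Module Tᵐᵒᵖ K] [Module Tᵐᵒᵖ M] [Module Tᵐᵒᵖ Q] [Module T N]
    (i : K →ₗ[Tᵐᵒᵖ] M) (q : M →ₗ[Tᵐᵒᵖ] Q) (hq : Function.Surjective q)
    (hiq : ∀ m, q m = 0 → ∃ k, i k = m) (x : M ⊠[T] N)
    (hx : map q (LinearMap.id : N →ₗ[T] N) x = 0) :
    ∃ y : K ⊠[T] N, map i (LinearMap.id : N →ₗ[T] N) y = x := by
  let I := (map i (LinearMap.id : N →ₗ[T] N)).range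
  let mk := QuotientAddGroup.mk' I
  have hmk : ∀ m m' n, q m = q m' → mk (tmul T m n) = mk (tmul T m' n) := by
    intro m m' n h
    obtain ⟨k, hk⟩ := hiq (m - m') (by rw [map_sub, h, sub_self])
    rw [← sub_eq_zero, ← map_sub, ← sub_tmul, ← hk]
    exact (QuotientAddGroup.eq_zero_iff _).2 ⟨tmul T k n, rfl⟩
  -- The section s is merely a map of sets; `hmk` makes the class independent of the chosen
  -- preimage, whence `r` is additive and balanced.
  choose s hs using hq
  let r : Q ⊠[T] N →+ (M ⊠[T] N) ⧸ I := lift (fun z n => mk (tmul T (s z) n))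
    (fun z z' n => by
      rw [← map_add, ← add_tmul]; exact hmk _ _ _ (by rw [map_add, hs, hs, hs]))
    (fun z n n' => by rw [tmul_add, map_add])
    (fun z t n => by
      rw [← op_smul_tmul]; exact hmk _ _ _ (by rw [map_smul, hs, hs]))
  have hr : ∀ x, r (map q LinearMap.id x) = mk x := tensor_hom_ext
    (f := r.comp (map q LinearMap.id)) (g := mk) (fun m n => hmk _ _ _ (hs _))
  have h := hr x
  rw [hx, map_zero] at h
  exact (QuotientAddGroup.eq_zero_iff _).1 h.symm

theorem exists_map_eq_of_map_eq_zero_right {K M Q N : Type*} [AddCommGroup K] [AddCommGroup M]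
    [AddCommGroup Q] [AddCommGroup N] [Module T K] [Module T M] [Module T Q] [Module Tᵐᵒᵖ N]
    (i : K →ₗ[T] M) (q : M →ₗ[T] Q) (hq : Function.Surjective q)
    (hiq : ∀ m, q m = 0 → ∃ k, i k = m) (x : N ⊠[T] M)
    (hx : map (LinearMap.id : N →ₗ[Tᵐᵒᵖ] N) q x = 0) :
    ∃ y : N ⊠[T] K, map (LinearMap.id : N →ₗ[Tᵐᵒᵖ] N) i y = x := by
  let I := (map (LinearMap.id : N →ₗ[Tᵐᵒᵖ] N) i).range
  let mk := QuotientAddGroup.mk' I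
  have hmk : ∀ m m' n, q m = q m' → mk (tmul T n m) = mk (tmul T n m') := by
    intro m m' n h
    obtain ⟨k, hk⟩ := hiq (m - m') (by rw [map_sub, h, sub_self])
    rw [← sub_eq_zero, ← map_sub, ← tmul_sub, ← hk]
    exact (QuotientAddGroup.eq_zero_iff _).2 ⟨tmul T n k, rfl⟩
  choose s hs using hq
  let r : N ⊠[T] Q →+ (N ⊠[T] M) ⧸ I := lift (fun n z => mk (tmul T n (s z)))
    (fun n n' z => by rw [add_tmul, map_add])
    (fun n z z' => by
      rw [← map_add, ← tmul_add]; exact hmk _ _ _ (by rw [map_add, hs, hs, hs]))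
    (fun n t z => by
      rw [op_smul_tmul]; exact hmk _ _ _ (by rw [map_smul, hs, hs]))
  have hr : ∀ x, r (map LinearMap.id q x) = mk x := tensor_hom_ext
    (f := r.comp (map LinearMap.id q)) (g := mk) (fun n m => hmk _ _ _ (hs _))
  have h := hr x
  rw [hx, map_zero] at h
  exact (QuotientAddGroup.eq_zero_iff _).1 h.symm

end Exactness

/-! ### Flat modules: kernels, retracts and tensor products. -/

section Flat

variable {T : Type u} [Ring T]

/-- Tensoring with a flat left module preserves kernels. -/
theorem IsFlatLeft.exists_map_eq {N : Type u} [AddCommGroup N] [Module T N] (hN : IsFlatLeft T N)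
    {K M P : Type u} [AddCommGroup K] [AddCommGroup M] [AddCommGroup P] [Module Tᵐᵒᵖ K]
    [Module Tᵐᵒᵖ M] [Module Tᵐᵒᵖ P] (i : K →ₗ[Tᵐᵒᵖ] M) (g : M →ₗ[Tᵐᵒᵖ] P)
    (hig : ∀ m, g m = 0 → ∃ k, i k = m) (x : M ⊠[T] N)
    (hx : map g (LinearMap.id : N →ₗ[T] N) x = 0) :
    ∃ y : K ⊠[T] N, map i (LinearMap.id : N →ₗ[T] N) y = x := by
  -- Factor g as M → M / ker g → P. By flatness the injective second factor stays injective after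
  -- tensoring, so x already dies in (M / ker g) ⊗ N, where right exactness applies.
  refine exists_map_eq_of_map_eq_zero_left i g.ker.mkQ (Submodule.mkQ_surjective _)
    (fun m hm => hig m (by simpa using hm)) x ?_
  refine hN _ _ (g.ker.liftQ g le_rfl) (LinearMap.ker_eq_bot.1 (Submodule.ker_liftQ_eq_bot _ _ _ le_rfl)) ?_
  rw [map_map, map_zero, Submodule.liftQ_mkQ]
  exact hx

/-- Tensoring with a flat right module preserves kernels. -/
theorem IsFlatRight.exists_map_eq {N : Type u} [AddCommGroup N] [Module Tᵐᵒᵖ N]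
    (hN : IsFlatRight T N) {K M P : Type u} [AddCommGroup K] [AddCommGroup M] [AddCommGroup P]
    [Module T K] [Module T M] [Module T P] (i : K →ₗ[T] M) (g : M →ₗ[T] P)
    (hig : ∀ m, g m = 0 → ∃ k, i k = m) (x : N ⊠[T] M)
    (hx : map (LinearMap.id : N →ₗ[Tᵐᵒᵖ] N) g x = 0) :
    ∃ y : N ⊠[T] K, map (LinearMap.id : N →ₗ[Tᵐᵒᵖ] N) i y = x := by
  refine exists_map_eq_of_map_eq_zero_right i g.ker.mkQ (Submodule.mkQ_surjective _)
    (fun m hm => hig m (by simpa using hm)) x ?_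
  refine hN _ _ (g.ker.liftQ g le_rfl) (LinearMap.ker_eq_bot.1 (Submodule.ker_liftQ_eq_bot _ _ _ le_rfl)) ?_
  rw [map_map, map_zero, Submodule.liftQ_mkQ]
  exact hx

/-- The retraction embeds X ⊗ N in X ⊗ M naturally in X, so injectivity for M passes down to N. -/
theorem IsFlatLeft.of_retract {M N : Type u} [AddCommGroup M] [AddCommGroup N] [Module T M]
    [Module T N] (hM : IsFlatLeft T M) (i : N →ₗ[T] M) (p : M →ₗ[T] N) (hp : ∀ n, p (i n) = n) :
    IsFlatLeft T N := by
  intro X Y _ _ _ _ f hf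
  refine Function.Injective.of_comp (f := map LinearMap.id i) ?_
  have h : ⇑(map (LinearMap.id : Y →ₗ[Tᵐᵒᵖ] Y) i) ∘ ⇑(map f LinearMap.id) =
      map f LinearMap.id ∘ map LinearMap.id i :=
    funext fun x => by simp [map_map]
  rw [h]
  refine (hM _ _ f hf).comp (Function.LeftInverse.injective (g := map LinearMap.id p) fun x => ?_)
  rw [map_map, show p ∘ₗ i = LinearMap.id from LinearMap.ext hp]
  exact map_id_id x

theorem IsFlatRight.of_retract {M N : Type u} [AddCommGroup M] [AddCommGroup N] [Module Tᵐᵒᵖ M]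
    [Module Tᵐᵒᵖ N] (hM : IsFlatRight T M) (i : N →ₗ[Tᵐᵒᵖ] M) (p : M →ₗ[Tᵐᵒᵖ] N)
    (hp : ∀ n, p (i n) = n) : IsFlatRight T N := by
  intro X Y _ _ _ _ f hf
  refine Function.Injective.of_comp (f := map i LinearMap.id) ?_
  have h : ⇑(map i (LinearMap.id : Y →ₗ[T] Y)) ∘ ⇑(map LinearMap.id f) =
      map LinearMap.id f ∘ map i LinearMap.id :=
    funext fun x => by simp [map_map]
  rw [h]
  refine (hM _ _ f hf).comp (Function.LeftInverse.injective (g := map p LinearMap.id) fun x => ?_)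
  rw [map_map, show p ∘ₗ i = LinearMap.id from LinearMap.ext hp]
  exact map_id_id x

/-- By associativity, tensoring with M ⊗ N is tensoring with M and then with N. -/
theorem IsFlatLeft.tensor {M N : Type u} [AddCommGroup M] [AddCommGroup N] [Module T M]
    [Module Tᵐᵒᵖ M] [SMulCommClass T Tᵐᵒᵖ M] [Module T N] (hM : IsFlatLeft T M)
    (hN : IsFlatLeft T N) : IsFlatLeft T (M ⊠[T] N) := by
  intro X Y _ _ _ _ f hf x y hxy
  obtain ⟨x, rfl⟩ := (assoc T T X M N).surjective x
  obtain ⟨y, rfl⟩ := (assoc T T X M N).surjective y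
  rw [← assoc_map_id_right, ← assoc_map_id_right] at hxy
  exact congrArg _ (hN _ _ (mapRight f LinearMap.id (fun _ _ => rfl)) (hM _ _ f hf)
    ((assoc T T Y M N).injective hxy))

theorem IsFlatRight.tensor {M N : Type u} [AddCommGroup M] [AddCommGroup N] [Module Tᵐᵒᵖ M]
    [Module T N] [Module Tᵐᵒᵖ N] [SMulCommClass T Tᵐᵒᵖ N] (hM : IsFlatRight T M)
    (hN : IsFlatRight T N) : IsFlatRight T (M ⊠[T] N) := by
  intro X Y _ _ _ _ f hf x y hxy
  have h := congrArg (assoc T T M N Y) hxy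
  rw [assoc_map_id_left, assoc_map_id_left] at h
  exact (assoc T T M N X).injective
    (hM _ _ (mapLeft LinearMap.id (fun _ _ => rfl) f) (hN _ _ f hf) h)

end Flat

/-! ### Relative injectivity from a colinear retraction of the coaction. -/

section Comodules

variable {R C : Type*} [Ring R] [AddCommGroup C] [Module R C] [Module Rᵐᵒᵖ C]
  [SMulCommClass R Rᵐᵒᵖ C] [Coring R C] {M : Type*} [AddCommGroup M]

/-- A left comodule whose coaction has a colinear retraction is relative injective. -/
theorem IsLeftComodule.isRelInjectiveLeft [Module R M] {ρ : M →ₗ[R] C ⊠[R] M}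
    (hρ : IsLeftComodule ρ) (π : C ⊠[R] M →ₗ[R] M) (hπ : ∀ m, π (ρ m) = m)
    (hcol : ∀ x, ρ (π x) = map LinearMap.id π
      (assoc R R C C M (map (Coring.comul (R := R) (C := C)).right LinearMap.id x))) :
    IsRelInjectiveLeft.{v} ρ := by
  refine ⟨hρ, fun N L _ _ _ _ ρN ρL hN hL i hi ⟨p, hp⟩ f hf => ?_⟩
  -- The map f ∘ p is only linear. Passing through the cofree comodule C ⊗ M makes it colinear, by
  -- coassociativity of L and colinearity of π.
  refine ⟨π ∘ₗ mapLeft LinearMap.id (fun _ _ => rfl) (f ∘ₗ p) ∘ₗ ρL, fun l => ?_, fun n => ?_⟩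
  · simp only [LinearMap.comp_apply, mapLeft_apply, hcol]
    have h : map (Coring.comul (R := R) (C := C)).right LinearMap.id
        (map LinearMap.id (f ∘ₗ p) (ρL l)) = map LinearMap.id (f ∘ₗ p)
          (map (Coring.comul (R := R) (C := C)).right LinearMap.id (ρL l)) := by
      simp [map_map]
    rw [h, assoc_map_id_left, hL.coassoc, map_map, map_map]
    rfl
  -- Along i the extension becomes π ∘ (C ⊗ f) ∘ ϱ_N = π ∘ ϱ ∘ f, and π undoes ϱ.
  · have h : f ∘ₗ p ∘ₗ i = f := LinearMap.ext fun n => by simp [hp]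
    simp only [LinearMap.comp_apply, mapLeft_apply, hi n, map_map]
    rw [LinearMap.comp_assoc, h, LinearMap.id_comp, ← hf, hπ]

/-- A right comodule whose coaction has a colinear retraction is relative injective. -/
theorem IsRightComodule.isRelInjectiveRight [Module Rᵐᵒᵖ M] {ρ : M →ₗ[Rᵐᵒᵖ] M ⊠[R] C}
    (hρ : IsRightComodule ρ) (π : M ⊠[R] C →ₗ[Rᵐᵒᵖ] M) (hπ : ∀ m, π (ρ m) = m)
    (hcol : ∀ x, ρ (π x) = map π LinearMap.id ((assoc R R M C C).symm
      (map LinearMap.id (Coring.comul (R := R) (C := C)).left x))) :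
    IsRelInjectiveRight.{v} ρ := by
  refine ⟨hρ, fun N L _ _ _ _ ρN ρL hN hL i hi ⟨p, hp⟩ f hf => ?_⟩
  refine ⟨π ∘ₗ mapRight (f ∘ₗ p) LinearMap.id (fun _ _ => rfl) ∘ₗ ρL, fun l => ?_, fun n => ?_⟩
  · simp only [LinearMap.comp_apply, mapRight_apply, hcol]
    have h : map LinearMap.id (Coring.comul (R := R) (C := C)).left
        (map (f ∘ₗ p) LinearMap.id (ρL l)) = map (f ∘ₗ p) LinearMap.id
          (map LinearMap.id (Coring.comul (R := R) (C := C)).left (ρL l)) := by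
      simp [map_map]
    rw [h, ← hL.coassoc, ← assoc_map_id_right, AddEquiv.symm_apply_apply, map_map, map_map]
    rfl
  · have h : f ∘ₗ p ∘ₗ i = f := LinearMap.ext fun n => by simp [hp]
    simp only [LinearMap.comp_apply, mapRight_apply, hi n, map_map]
    rw [LinearMap.comp_assoc, h, LinearMap.id_comp, ← hf, hπ]

end Comodules

theorem map_mulHom_assoc_symm_tmul {R A C : Type*} [Ring R] [Ring A] [Module R A]
    [Module Rᵐᵒᵖ A] [RRing R A] [AddCommGroup C] [Module R C] (a : A) (y : A ⊠[R] C) :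
    map (mulHom R A).right LinearMap.id ((assoc R R A A C).symm (tmul R a y)) = a • y := by
  induction y using tensor_induction with
  | zero => simp
  | pure a c => simp
  | add x y hx hy => rw [tmul_add, map_add, map_add, hx, hy, smul_add]

/-! ### The inverse entwining map and the two coactions on A. -/

namespace BijEntwining

variable {R A C : Type*} [Ring R] [Ring A] [Module R A] [Module Rᵐᵒᵖ A] [RRing R A]
  [AddCommGroup C] [Module R C] [Module Rᵐᵒᵖ C] [SMulCommClass R Rᵐᵒᵖ C] [Coring R C]
  (E : BijEntwining R A C) (e : C)

/-- The inverse of `ψ` as a bimodule map. -/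
noncomputable def psiInv : BimodHom R R (A ⊠[R] C) (C ⊠[R] A) where
  toAddMonoidHom := E.equiv.symm.toAddMonoidHom
  map_smul' r x := E.equiv.injective <| by
    change E.ψ (E.equiv.symm (r • x)) = E.ψ (r • E.equiv.symm x)
    rw [psi_equiv_symm]
    exact ((E.ψ.map_smul' r _).trans (congrArg (r • ·) (E.psi_equiv_symm x))).symm
  map_op_smul' r x := E.equiv.injective <| by
    change E.ψ (E.equiv.symm (op r • x)) = E.ψ (op r • E.equiv.symm x)
    rw [psi_equiv_symm]
    exact ((E.ψ.map_op_smul' r _).trans (congrArg (op r • ·) (E.psi_equiv_symm x))).symm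

@[simp] theorem psi_psiInv (x : A ⊠[R] C) : E.ψ (E.psiInv x) = x := E.equiv.apply_symm_apply x

@[simp] theorem psiInv_psi (x : C ⊠[R] A) : E.psiInv (E.ψ x) = x := E.equiv.symm_apply_apply x

theorem left_comp_left_psiInv : E.ψ.left ∘ₗ E.psiInv.left = LinearMap.id :=
  LinearMap.ext E.psi_psiInv

theorem right_comp_right_psiInv : E.ψ.right ∘ₗ E.psiInv.right = LinearMap.id :=
  LinearMap.ext E.psi_psiInv

theorem psiInv_left_comp_left : E.psiInv.left ∘ₗ E.ψ.left = LinearMap.id :=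
  LinearMap.ext E.psiInv_psi

theorem psiInv_right_comp_right : E.psiInv.right ∘ₗ E.ψ.right = LinearMap.id :=
  LinearMap.ext E.psiInv_psi

theorem psi_op_smul (x : C ⊠[R] A) (b : A) :
    E.ψ (op b • x) = map (mulHom R A).right LinearMap.id ((assoc R R A A C).symm
      (map LinearMap.id E.ψ.left (assoc R R A C A (tmul R (E.ψ x) b)))) := by
  have h := E.psi_mul (tmul R x b)
  rw [map_tmul] at h
  refine Eq.trans (congrArg E.ψ ?_) h
  clear h
  induction x using tensor_induction with
  | zero => simp
  | pure c a => simp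
  | add x y hx hy => rw [smul_add, hx, hy, add_tmul, map_add, map_add]

/-- Compatibility of `ψ⁻¹` with the multiplication of `A`. -/
theorem psiInv_smul (a : A) (y : A ⊠[R] C) :
    E.psiInv (a • y) = map LinearMap.id (mulHom R A).left (assoc R R C A A
      (map E.psiInv.right LinearMap.id ((assoc R R A C A).symm (tmul R a (E.psiInv y))))) := by
  refine E.equiv.injective ?_
  change E.ψ _ = E.ψ _
  rw [psi_psiInv]
  -- Multiplicativity of ψ puts ψ ⊗ A directly against ψ⁻¹ ⊗ A, and the two cancel.
  have key : ∀ z : C ⊠[R] A, E.ψ (map LinearMap.id (mulHom R A).left (assoc R R C A A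
      (map E.psiInv.right LinearMap.id ((assoc R R A C A).symm (tmul R a z))))) =
      a • E.ψ z := by
    intro z
    rw [E.psi_mul, map_map, right_comp_right_psiInv, LinearMap.id_comp, map_id_id,
      AddEquiv.apply_symm_apply, map_tmul, map_mulHom_assoc_symm_tmul]
    rfl
  rw [key, psi_psiInv]

/-- Compatibility of `ψ⁻¹` with the comultiplication of `C`. -/
theorem psiInv_comul (y : A ⊠[R] C) :
    map (Coring.comul (R := R) (C := C)).right LinearMap.id (E.psiInv y) =
      (assoc R R C C A).symm (map LinearMap.id E.psiInv.left (assoc R R C A C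
        (map E.psiInv.right LinearMap.id ((assoc R R A C C).symm
          (map LinearMap.id (Coring.comul (R := R) (C := C)).left y))))) := by
  have h := E.psi_comul (E.psiInv y)
  rw [psi_psiInv] at h
  rw [h, AddEquiv.symm_apply_apply, map_map, psiInv_right_comp_right, LinearMap.id_comp,
    map_id_id, AddEquiv.apply_symm_apply, map_map, psiInv_left_comp_left, LinearMap.id_comp,
    map_id_id, AddEquiv.symm_apply_apply]

theorem psiInv_counit (y : A ⊠[R] C) :
    lid R A (map (Coring.counit (R := R) (C := C)).right LinearMap.id (E.psiInv y)) =
      rid R A (map LinearMap.id (Coring.counit (R := R) (C := C)).left y) := by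
  rw [← E.psi_counit, psi_psiInv]

theorem psiInv_one (c : C) : E.psiInv (tmul R 1 c) = tmul R c 1 := by
  rw [← E.psi_one, psiInv_psi]

theorem leftCoaction_eq (a : A) : E.leftCoaction e a = E.psiInv (tmul R a e) := rfl

variable {e}

theorem rightCoaction_counit (he : IsGrouplike R e) (a : A) :
    rid R A (map LinearMap.id (Coring.counit (R := R) (C := C)).left (E.rightCoaction e a)) =
      a := by
  rw [rightCoaction_apply, E.psi_counit, map_tmul, BimodHom.right_apply, he.counit_eq, lid_tmul,
    one_smul, LinearMap.id_apply]

/-- Coassociativity is the compatibility of ψ with Δ, read at e ⊗ a with Δ(e) = e ⊗ e. -/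
theorem isRightComodule_rightCoaction (he : IsGrouplike R e) :
    IsRightComodule (E.rightCoaction e) where
  counit := E.rightCoaction_counit he
  coassoc a := by
    rw [rightCoaction_apply, E.psi_comul, map_tmul, BimodHom.right_apply, he.comul_eq,
      assoc_tmul, map_tmul]
    congr 1
    change _ = map E.ψ.right LinearMap.id
      ((assoc R R C A C).symm (tmul R e (E.ψ (tmul R e a))))
    generalize E.ψ (tmul R e a) = y
    induction y using tensor_induction with
    | zero => simp
    | pure a c => simp [rightCoaction_apply]
    | add x y hx hy => rw [map_add, hx, hy, tmul_add, map_add, map_add]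

theorem isLeftComodule_leftCoaction (he : IsGrouplike R e) :
    IsLeftComodule (E.leftCoaction e) where
  counit a := by
    rw [leftCoaction_eq, psiInv_counit, map_tmul, BimodHom.left_apply, he.counit_eq, rid_tmul,
      op_one, one_smul, LinearMap.id_apply]
  coassoc a := by
    rw [leftCoaction_eq, psiInv_comul, AddEquiv.apply_symm_apply, map_tmul, BimodHom.left_apply,
      he.comul_eq, assoc_symm_tmul, map_tmul]
    change map LinearMap.id E.psiInv.left
      (assoc R R C A C (tmul R (E.psiInv (tmul R a e)) e)) = _
    generalize E.psiInv (tmul R a e) = y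
    induction y using tensor_induction with
    | zero => simp
    | pure c a => simp [leftCoaction_eq]
    | add x y hx hy => rw [map_add, ← hx, ← hy, add_tmul, map_add, map_add]

/-- Both conditions say ψ(e ⊗ b) = b ⊗ e, so the left and right coactions have the same
coinvariants. -/
theorem isCoinvariant_iff_leftCoaction {b : A} :
    E.IsCoinvariant e b ↔ E.leftCoaction e b = tmul R e b := by
  rw [IsCoinvariant, rightCoaction_apply, leftCoaction_eq]
  constructor
  · intro h
    rw [← h, psiInv_psi]
  · intro h
    rw [← h, psi_psiInv]

end BijEntwining

/-! ### Actions of A on modules and tensor products. -/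

section ScalarTower

variable {R S A : Type*} [Ring R] [Ring S] [Ring A] [Module R A] [Module Rᵐᵒᵖ A] [RRing R A]
  [Module S A] [Module Sᵐᵒᵖ A] [RRing S A] {N : Type*} [AddCommGroup N]

instance isScalarTower_tensor [Module S N] : IsScalarTower R A (A ⊠[S] N) where
  smul_assoc r a := tensor_hom_ext (f := DistribSMul.toAddMonoidHom _ (r • a))
    (g := (DistribSMul.toAddMonoidHom _ r).comp (DistribSMul.toAddMonoidHom _ a))
    (fun x n => congrArg (tmul S · n) (smul_assoc r a x))

instance isScalarTower_op : IsScalarTower Rᵐᵒᵖ Aᵐᵒᵖ A where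
  smul_assoc r a b := by
    change b * (r • a.unop) = r • (b * a.unop)
    rw [← op_unop r, RRing.op_smul_def, RRing.op_smul_def, mul_assoc]

instance isScalarTower_op_tensor [Module Sᵐᵒᵖ N] : IsScalarTower Rᵐᵒᵖ Aᵐᵒᵖ (N ⊠[S] A) where
  smul_assoc r a := tensor_hom_ext (f := DistribSMul.toAddMonoidHom _ (r • a))
    (g := (DistribSMul.toAddMonoidHom _ r).comp (DistribSMul.toAddMonoidHom _ a))
    (fun n x => congrArg (tmul S n) (smul_assoc r a x))

variable (R A N) in
/-- The action `A ⊗_R N → N` of an `R`-ring `A` on a left `A`-module `N`. -/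
def actLeft [Module A N] [Module R N] [IsScalarTower R A N] : A ⊠[R] N →ₗ[A] N where
  toFun := act R A N (fun a r n => by
    rw [RRing.op_smul_def, mul_smul, ← smul_one_smul A r n, RRing.smul_def, mul_one])
  map_add' := map_add _
  map_smul' a x := by
    induction x using tensor_induction with
    | zero => simp
    | pure b n => simp [mul_smul]
    | add x y hx hy => rw [smul_add, map_add, hx, hy, map_add, smul_add]

@[simp] theorem actLeft_tmul [Module A N] [Module R N] [IsScalarTower R A N] (a : A) (n : N) :
    actLeft R A N (tmul R a n) = a • n := rfl

variable (R A N) in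
/-- The action `N ⊗_R A → N` of an `R`-ring `A` on a right `A`-module `N`. -/
def actRight [Module Aᵐᵒᵖ N] [Module Rᵐᵒᵖ N] [IsScalarTower Rᵐᵒᵖ Aᵐᵒᵖ N] :
    N ⊠[R] A →ₗ[Aᵐᵒᵖ] N where
  toFun := lift (fun n a => op a • n) (fun n n' a => smul_add _ n n')
    (fun n a b => by rw [op_add, add_smul])
    (fun n r a => by
      rw [RRing.smul_def, op_mul, mul_smul, ← smul_one_smul Aᵐᵒᵖ (op r) n]
      congr 2
      change op (op r • (1 : A)) = _
      rw [RRing.op_smul_def, one_mul])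
  map_add' := map_add _
  map_smul' a x := by
    induction x using tensor_induction with
    | zero => simp
    | pure n b => exact mul_smul a (op b) n
    | add x y hx hy => rw [smul_add, map_add, hx, hy, map_add, smul_add]

@[simp] theorem actRight_tmul [Module Aᵐᵒᵖ N] [Module Rᵐᵒᵖ N] [IsScalarTower Rᵐᵒᵖ Aᵐᵒᵖ N]
    (n : N) (a : A) : actRight R A N (tmul R n a) = op a • n := rfl

end ScalarTower

namespace BijEntwining

variable {R A C : Type*} [Ring R] [Ring A] [Module R A] [Module Rᵐᵒᵖ A] [RRing R A]
  [AddCommGroup C] [Module R C] [Module Rᵐᵒᵖ C] [SMulCommClass R Rᵐᵒᵖ C] [Coring R C]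
  {E : BijEntwining R A C} {e : C}
  {T : Type*} [Ring T] [Module T A] [Module Tᵐᵒᵖ A] [RRing T A]

/-! ### Left colinearity of the map built from ℓ and ψ. -/

section Translation

variable (ℓ : BimodHom R R C (A ⊠[T] A))

/-- The map `A ⊗_R C → A ⊗_T A`, `a ⊗ c ↦ a ℓ(c)`. -/
def translationLeft : A ⊠[R] C →ₗ[A] A ⊠[T] A :=
  actLeft R A (A ⊠[T] A) ∘ₗ mapLeft LinearMap.id (fun _ _ => rfl) ℓ.left

@[simp] theorem translationLeft_tmul (a : A) (c : C) :
    translationLeft ℓ (tmul R a c) = a • ℓ c := rfl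

variable (hT : ∀ t : T, E.IsCoinvariant e (RRing.unit t : A))

@[simp] theorem rightCoactionT_apply (a : A) :
    rightCoactionT hT a = E.rightCoaction e a := rfl

@[simp] theorem leftCoactionT_apply (a : A) :
    leftCoactionT hT a = E.leftCoaction e a := rfl

theorem tensorLeftCoaction_add (x y : A ⊠[T] A) : tensorLeftCoaction hT (x + y) =
    tensorLeftCoaction hT x + tensorLeftCoaction hT y := by
  simp only [tensorLeftCoaction, map_add]

theorem tensorLeftCoaction_zero : tensorLeftCoaction hT (0 : A ⊠[T] A) = 0 := by
  simp only [tensorLeftCoaction, map_zero]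

variable (E T) in
/-- The map `a ⊗ (c ⊗ z) ↦ ψ⁻¹(a ⊗ c) z`. -/
noncomputable def twistLeft : A ⊠[R] (C ⊠[R] (A ⊠[T] A)) →+ C ⊠[R] (A ⊠[T] A) :=
  (map LinearMap.id ((actLeft R A (A ⊠[T] A)).restrictScalars R)).comp
    ((assoc R R C A (A ⊠[T] A)).toAddMonoidHom.comp
      ((map E.psiInv.right LinearMap.id).comp (assoc R R A C (A ⊠[T] A)).symm.toAddMonoidHom))

theorem twistLeft_tmul (a : A) (c : C) (z : A ⊠[T] A) :
    twistLeft E T (tmul R a (tmul R c z)) =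
      map LinearMap.id ((actLeft R A (A ⊠[T] A)).restrictScalars R)
        (assoc R R C A (A ⊠[T] A) (tmul R (E.psiInv (tmul R a c)) z)) := rfl

/-- The left coaction is not left A-linear: by multiplicativity of ψ⁻¹, a scalar moves past it at
the cost of a twist by ψ⁻¹. -/
theorem tensorLeftCoaction_smul (a : A) (z : A ⊠[T] A) :
    tensorLeftCoaction hT (a • z) = twistLeft E T (tmul R a (tensorLeftCoaction hT z)) := by
  induction z using tensor_induction with
  | zero => simp [tensorLeftCoaction_zero]
  | pure x y =>
    have h := E.psiInv_smul a (tmul R x e)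
    rw [← leftCoaction_eq, smul_tmul, ← leftCoaction_eq] at h
    simp only [tensorLeftCoaction, smul_tmul, map_tmul, leftCoactionT_apply, LinearMap.id_apply, h]
    generalize E.leftCoaction e x = w
    induction w using tensor_induction with
    | zero => simp
    | pure c b =>
      rw [assoc_tmul, twistLeft_tmul, assoc_symm_tmul, map_tmul, BimodHom.right_apply,
        LinearMap.id_apply]
      generalize E.psiInv (tmul R a c) = v
      induction v using tensor_induction with
      | zero => simp
      | pure c a => rfl
      | add v w hv hw => simp only [map_add, add_tmul, hv, hw]
    | add v w hv hw => simp only [map_add, add_tmul, tmul_add, hv, hw]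
  | add x y hx hy =>
    rw [smul_add, tensorLeftCoaction_add, hx, hy, tensorLeftCoaction_add, tmul_add, map_add]

variable {ℓ} {hT}

/-- With Δ(c) = ∑ c₁ ⊗ c₂, left colinearity of ℓ and the twisting rule express the coaction of a
ℓ(c) through ψ⁻¹(a ⊗ c₁) acting on ℓ(c₂). -/
theorem IsStrongConnection.tensorLeftCoaction_translationLeft (hℓ : IsStrongConnection hT ℓ)
    (w : A ⊠[R] C) : tensorLeftCoaction hT (translationLeft ℓ w) =
      map LinearMap.id ((translationLeft ℓ).restrictScalars R) (assoc R R C A C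
        (map E.psiInv.right LinearMap.id ((assoc R R A C C).symm
          (map LinearMap.id (Coring.comul (R := R) (C := C)).left w)))) := by
  induction w using tensor_induction with
  | zero => simp [tensorLeftCoaction_zero]
  | pure a c =>
    rw [translationLeft_tmul, tensorLeftCoaction_smul, hℓ.left_colinear, map_tmul,
      BimodHom.left_apply]
    generalize Coring.comul (R := R) c = d
    induction d using tensor_induction with
    | zero => simp
    | pure c c' =>
      rw [map_tmul, LinearMap.id_apply, LinearMap.id_apply, twistLeft_tmul, assoc_symm_tmul,
        map_tmul, BimodHom.right_apply]
      generalize E.psiInv (tmul R a c) = v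
      induction v using tensor_induction with
      | zero => simp
      | pure c a => rfl
      | add v w hv hw => simp only [map_add, add_tmul, hv, hw]
    | add v w hv hw => simp only [map_add, tmul_add, hv, hw]
  | add x y hx hy => simp only [map_add, tensorLeftCoaction_add, hx, hy]

variable (E ℓ) in
/-- The left colinear map `C ⊗_R A → A ⊗_T A` sending `c ⊗ a` to `∑ aᵢ ℓ(cᵢ)`, where
`ψ(c ⊗ a) = ∑ aᵢ ⊗ cᵢ`. -/
def entwinedTranslationLeft : C ⊠[R] A →ₗ[R] A ⊠[T] A :=
  (translationLeft ℓ).restrictScalars R ∘ₗ E.ψ.left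

/-- Compatibility of ψ with Δ says that ψ carries the coaction Δ ⊗ A on C ⊗_R A to (ψ⁻¹ ⊗ C) ∘ (A ⊗
Δ) on A ⊗_R C, for which the translation map is already colinear. -/
theorem IsStrongConnection.tensorLeftCoaction_entwinedTranslationLeft
    (hℓ : IsStrongConnection hT ℓ) (x : C ⊠[R] A) :
    tensorLeftCoaction hT (entwinedTranslationLeft E ℓ x) =
      map LinearMap.id (entwinedTranslationLeft E ℓ)
        (assoc R R C C A (map (Coring.comul (R := R) (C := C)).right LinearMap.id x)) := by
  refine (hℓ.tensorLeftCoaction_translationLeft (E.ψ x)).trans ?_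
  rw [E.psi_comul, AddEquiv.symm_apply_apply, map_map, psiInv_right_comp_right,
    LinearMap.id_comp, map_id_id, AddEquiv.apply_symm_apply, map_map]
  rfl

end Translation

/-! ### The canonical map splits the translation map and determines products. -/

section Unit

variable {hT : ∀ t : T, E.IsCoinvariant e (RRing.unit t : A)} {ℓ : BimodHom R R C (A ⊠[T] A)}

@[simp] theorem liftedCan_tmul (a b : A) :
    liftedCan hT (tmul T a b) = a • E.rightCoaction e b := rfl

/-- Applying A ⊗ ε to a ϱ(b) gives ab by counitality. Hence the condition on ℓ under the canonical
map fixes the product of ℓ(c). -/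
theorem mulHom_eq_counit_liftedCan (he : IsGrouplike R e) (z : A ⊠[T] A) :
    mulHom T A z =
      rid R A (map LinearMap.id (Coring.counit (R := R) (C := C)).left (liftedCan hT z)) := by
  induction z using tensor_induction with
  | zero => simp
  | pure a b =>
    rw [liftedCan_tmul, mulHom_tmul]
    -- Once the bare b is written through ϱ(b) as well, ϱ(b) can be generalized to an arbitrary
    -- tensor.
    conv_lhs => rw [← E.rightCoaction_counit he b]
    generalize E.rightCoaction e b = w
    induction w using tensor_induction with
    | zero => simp
    | pure b c => simp [RRing.op_smul_def, mul_assoc]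
    | add v w hv hw => simp only [map_add, smul_add, mul_add, hv, hw]
  | add x y hx hy => simp only [map_add, hx, hy]

theorem IsStrongConnection.mulHom_grouplike (hℓ : IsStrongConnection hT ℓ)
    (he : IsGrouplike R e) : mulHom T A (ℓ e) = 1 := by
  rw [mulHom_eq_counit_liftedCan (hT := hT) he, hℓ.can_eq, map_tmul, BimodHom.left_apply,
    he.counit_eq, rid_tmul, op_one, one_smul, LinearMap.id_apply]

variable (hT) in
/-- The lifted canonical map is left `A`-linear. -/
def liftedCanLeft : A ⊠[T] A →ₗ[A] A ⊠[R] C where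
  toFun := liftedCan hT
  map_add' := map_add _
  map_smul' a z := by
    induction z using tensor_induction with
    | zero => simp
    | pure x y => simp [mul_smul]
    | add x y hx hy => rw [smul_add, map_add, hx, hy, map_add, smul_add]

theorem IsStrongConnection.liftedCanLeft_translationLeft (hℓ : IsStrongConnection hT ℓ)
    (w : A ⊠[R] C) : liftedCanLeft hT (translationLeft ℓ w) = w := by
  induction w using tensor_induction with
  | zero => simp
  | pure a c =>
    rw [translationLeft_tmul, map_smul]
    exact (congrArg (a • ·) (hℓ.can_eq c)).trans (by simp)
  | add x y hx hy => rw [map_add, map_add, hx, hy]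

end Unit

/-! ### Right colinearity of the mirrored map. -/

section TranslationRight

variable (ℓ : BimodHom R R C (A ⊠[T] A))

/-- The map `C ⊗_R A → A ⊗_T A`, `c ⊗ a ↦ ℓ(c) a`. -/
def translationRight : C ⊠[R] A →ₗ[Aᵐᵒᵖ] A ⊠[T] A :=
  actRight R A (A ⊠[T] A) ∘ₗ mapRight ℓ.right LinearMap.id (fun _ _ => rfl)

@[simp] theorem translationRight_tmul (c : C) (a : A) :
    translationRight ℓ (tmul R c a) = op a • ℓ c := rfl

variable (hT : ∀ t : T, E.IsCoinvariant e (RRing.unit t : A))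

theorem tensorRightCoaction_add (x y : A ⊠[T] A) : tensorRightCoaction hT (x + y) =
    tensorRightCoaction hT x + tensorRightCoaction hT y := by
  simp only [tensorRightCoaction, map_add]

theorem tensorRightCoaction_zero : tensorRightCoaction hT (0 : A ⊠[T] A) = 0 := by
  simp only [tensorRightCoaction, map_zero]

variable (E T) in
/-- The map `(z ⊗ c) ⊗ a ↦ z ψ(c ⊗ a)`. -/
def twistRight : ((A ⊠[T] A) ⊠[R] C) ⊠[R] A →+ (A ⊠[T] A) ⊠[R] C :=
  (map ((actRight R A (A ⊠[T] A)).restrictScalars Rᵐᵒᵖ) LinearMap.id).comp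
    ((assoc R R (A ⊠[T] A) A C).symm.toAddMonoidHom.comp
      ((map LinearMap.id E.ψ.left).comp (assoc R R (A ⊠[T] A) C A).toAddMonoidHom))

theorem twistRight_tmul (z : A ⊠[T] A) (c : C) (a : A) :
    twistRight E T (tmul R (tmul R z c) a) =
      map ((actRight R A (A ⊠[T] A)).restrictScalars Rᵐᵒᵖ) LinearMap.id
        ((assoc R R (A ⊠[T] A) A C).symm (tmul R z (E.ψ (tmul R c a)))) := rfl

/-- Here right multiplication passes the right coaction at the cost of ψ itself, by `psi_op_smul`.
-/
theorem tensorRightCoaction_op_smul (a : A) (z : A ⊠[T] A) :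
    tensorRightCoaction hT (op a • z) =
      twistRight E T (tmul R (tensorRightCoaction hT z) a) := by
  induction z using tensor_induction with
  | zero => simp [tensorRightCoaction_zero]
  | pure x y =>
    have h := E.psi_op_smul (tmul R e y) a
    rw [← rightCoaction_apply, tmul_op_smul, ← rightCoaction_apply] at h
    simp only [tensorRightCoaction, tmul_op_smul, map_tmul, rightCoactionT_apply,
      LinearMap.id_apply, h]
    generalize E.rightCoaction e y = w
    induction w using tensor_induction with
    | zero => simp
    | pure b c =>
      rw [assoc_symm_tmul, twistRight_tmul, assoc_tmul, map_tmul, BimodHom.left_apply,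
        LinearMap.id_apply]
      generalize E.ψ (tmul R c a) = v
      induction v using tensor_induction with
      | zero => simp
      | pure a c => rfl
      | add v w hv hw => simp only [map_add, tmul_add, hv, hw]
    | add v w hv hw => simp only [map_add, add_tmul, tmul_add, hv, hw]
  | add x y hx hy =>
    rw [smul_add, tensorRightCoaction_add, hx, hy, tensorRightCoaction_add, add_tmul, map_add]

variable {ℓ} {hT}

theorem IsStrongConnection.tensorRightCoaction_translationRight (hℓ : IsStrongConnection hT ℓ)
    (w : C ⊠[R] A) : tensorRightCoaction hT (translationRight ℓ w) =
      map ((translationRight ℓ).restrictScalars Rᵐᵒᵖ) LinearMap.id ((assoc R R C A C).symm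
        (map LinearMap.id E.ψ.left (assoc R R C C A
          (map (Coring.comul (R := R) (C := C)).right LinearMap.id w)))) := by
  induction w using tensor_induction with
  | zero => simp [tensorRightCoaction_zero]
  | pure c a =>
    rw [translationRight_tmul, tensorRightCoaction_op_smul, hℓ.right_colinear, map_tmul,
      BimodHom.right_apply]
    generalize Coring.comul (R := R) c = d
    induction d using tensor_induction with
    | zero => simp
    | pure c c' =>
      rw [map_tmul, LinearMap.id_apply, LinearMap.id_apply, twistRight_tmul, assoc_tmul,
        map_tmul, BimodHom.left_apply]
      generalize E.ψ (tmul R c' a) = v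
      induction v using tensor_induction with
      | zero => simp
      | pure a c => rfl
      | add v w hv hw => simp only [map_add, tmul_add, hv, hw]
    | add v w hv hw => simp only [map_add, add_tmul, hv, hw]
  | add x y hx hy => simp only [map_add, tensorRightCoaction_add, hx, hy]

variable (E ℓ) in
/-- The right colinear map `A ⊗_R C → A ⊗_T A` sending `a ⊗ c` to `∑ ℓ(cᵢ) aᵢ`, where
`ψ⁻¹(a ⊗ c) = ∑ cᵢ ⊗ aᵢ`. -/
noncomputable def entwinedTranslationRight : A ⊠[R] C →ₗ[Rᵐᵒᵖ] A ⊠[T] A :=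
  (translationRight ℓ).restrictScalars Rᵐᵒᵖ ∘ₗ E.psiInv.right

/-- `psiInv_comul` identifies the coaction A ⊗ Δ on A ⊗_R C with the one on C ⊗_R A for which c ⊗ a
↦ ℓ(c) a is colinear. -/
theorem IsStrongConnection.tensorRightCoaction_entwinedTranslationRight
    (hℓ : IsStrongConnection hT ℓ) (x : A ⊠[R] C) :
    tensorRightCoaction hT (entwinedTranslationRight E ℓ x) =
      map (entwinedTranslationRight E ℓ) LinearMap.id
        ((assoc R R A C C).symm (map LinearMap.id (Coring.comul (R := R) (C := C)).left x)) := by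
  refine (hℓ.tensorRightCoaction_translationRight (E.psiInv x)).trans ?_
  rw [E.psiInv_comul, AddEquiv.apply_symm_apply, map_map, left_comp_left_psiInv,
    LinearMap.id_comp, map_id_id, AddEquiv.symm_apply_apply, map_map]
  rfl

end TranslationRight

/-! ### The right-handed canonical map and its splitting. -/

section UnitRight

variable {hT : ∀ t : T, E.IsCoinvariant e (RRing.unit t : A)} {ℓ : BimodHom R R C (A ⊠[T] A)}

variable (hT) in
/-- The right `A`-linear map `A ⊗_T A → C ⊗_R A` corresponding to the lifted canonical map under
the isomorphism `ψ`. -/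
noncomputable def liftedCanRight : A ⊠[T] A →ₗ[Aᵐᵒᵖ] C ⊠[R] A :=
  actRight T A (C ⊠[R] A) ∘ₗ mapRight (leftCoactionT hT) LinearMap.id (fun _ _ => rfl)

theorem liftedCanRight_tmul (a b : A) :
    liftedCanRight hT (tmul T a b) = op b • E.leftCoaction e a := rfl

/-- Multiplicativity gives ψ(ψ⁻¹(a ⊗ e) b) = a ψ(e ⊗ b). The one condition on ℓ under the canonical
map therefore serves both sides. -/
theorem psi_liftedCanRight (z : A ⊠[T] A) : E.ψ (liftedCanRight hT z) = liftedCan hT z := by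
  induction z using tensor_induction with
  | zero => simp
  | pure a b =>
    rw [liftedCanRight_tmul, liftedCan_tmul, psi_op_smul, leftCoaction_eq, psi_psiInv, assoc_tmul,
      map_tmul, map_mulHom_assoc_symm_tmul]
    rfl
  | add x y hx hy => simp only [map_add, hx, hy]

theorem IsStrongConnection.liftedCanRight_translationRight (hℓ : IsStrongConnection hT ℓ)
    (w : C ⊠[R] A) : liftedCanRight hT (translationRight ℓ w) = w := by
  induction w using tensor_induction with
  | zero => simp
  | pure c a =>
    rw [translationRight_tmul, map_smul]
    have h : liftedCanRight hT (ℓ c) = tmul R c 1 := by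
      rw [← E.psiInv_psi (liftedCanRight hT (ℓ c)), psi_liftedCanRight, hℓ.can_eq, psiInv_one]
    rw [h]
    simp
  | add x y hx hy => rw [map_add, map_add, hx, hy]

end UnitRight

end BijEntwining

namespace BijEntwining

/-! ### Coinvariants as kernels, and their lifts along flat modules. -/

section Coinvariants

variable {R : Type*} {A C B T : Type u} [Ring R] [Ring A] [Module R A] [Module Rᵐᵒᵖ A] [RRing R A]
  [AddCommGroup C] [Module R C] [Module Rᵐᵒᵖ C] [SMulCommClass R Rᵐᵒᵖ C] [Coring R C]
  {E : BijEntwining R A C} {e : C} [Ring T] [Module T A] [Module Tᵐᵒᵖ A] [RRing T A]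
  [AddCommGroup B] [Module T B] [Module Tᵐᵒᵖ B]
  {hT : ∀ t : T, E.IsCoinvariant e (RRing.unit t : A)} {ℓ : BimodHom R R C (A ⊠[T] A)}
  {j : BimodHom T T B A}

theorem IsCoinvariant.zero : E.IsCoinvariant e 0 := by
  rw [IsCoinvariant, map_zero, zero_tmul]

theorem IsCoinvariant.add {a b : A} (ha : E.IsCoinvariant e a) (hb : E.IsCoinvariant e b) :
    E.IsCoinvariant e (a + b) := by
  rw [IsCoinvariant, map_add, add_tmul, ha, hb]

theorem IsCoinvariant.mul {a b : A} (ha : E.IsCoinvariant e a) (hb : E.IsCoinvariant e b) :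
    E.IsCoinvariant e (a * b) := by
  rw [IsCoinvariant, ha.rightCoaction_mul, hb, smul_tmul, smul_eq_mul]

/-- Used with X ⊗ Y = B ⊗_T A or A ⊗_T B, to see that the retraction φ takes coinvariant values. -/
theorem isCoinvariant_mulHom_map {X Y : Type*}
    [AddCommGroup X] [AddCommGroup Y] [Module Tᵐᵒᵖ X] [Module T Y] (g : X →ₗ[Tᵐᵒᵖ] A)
    (h : Y →ₗ[T] A) (hg : ∀ x, E.IsCoinvariant e (g x)) (hh : ∀ y, E.IsCoinvariant e (h y))
    (z : X ⊠[T] Y) : E.IsCoinvariant e (mulHom T A (map g h z)) := by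
  induction z using tensor_induction with
  | zero => rw [map_zero, map_zero]; exact IsCoinvariant.zero
  | pure x y => exact (hg x).mul (hh y)
  | add x y hx hy => rw [map_add, map_add]; exact hx.add hy

variable (hT) in
-- Associativity carries (d ⊗ A)(x) to the difference of the coaction of x and e ⊗ x. Coinvariance
-- in A ⊗_T A thus becomes a kernel condition to which flatness applies.
theorem map_leftCoactionT_sub (x : A ⊠[T] A) (hx : tensorLeftCoaction hT x = tmul R e x)
    (d : A →ₗ[Tᵐᵒᵖ] C ⊠[R] A) (hd : ∀ a, d a = E.leftCoaction e a - tmul R e a) :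
    map d (LinearMap.id : A →ₗ[T] A) x = 0 := by
  refine (assoc R T C A A).injective ?_
  have h : ∀ x, assoc R T C A A (map d (LinearMap.id : A →ₗ[T] A) x) =
      tensorLeftCoaction hT x - tmul R e x := by
    intro x
    induction x using tensor_induction with
    | zero => simp [tensorLeftCoaction_zero]
    | pure a b =>
      rw [map_tmul, hd, sub_tmul, map_sub, assoc_tmul]
      rfl
    | add x y hx hy =>
      rw [map_add, map_add, hx, hy, tensorLeftCoaction_add, tmul_add]
      abel
  rw [h, hx, sub_self, map_zero]

variable (hT) in
theorem map_rightCoactionT_sub (x : A ⊠[T] A) (hx : tensorRightCoaction hT x = tmul R x e)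
    (d : A →ₗ[T] A ⊠[R] C) (hd : ∀ a, d a = E.rightCoaction e a - tmul R a e) :
    map (LinearMap.id : A →ₗ[Tᵐᵒᵖ] A) d x = 0 := by
  refine (assoc T R A A C).symm.injective ?_
  have h : ∀ x, (assoc T R A A C).symm (map (LinearMap.id : A →ₗ[Tᵐᵒᵖ] A) d x) =
      tensorRightCoaction hT x - tmul R x e := by
    intro x
    induction x using tensor_induction with
    | zero => simp [tensorRightCoaction_zero]
    | pure a b =>
      rw [map_tmul, hd, tmul_sub, map_sub, LinearMap.id_apply, assoc_symm_tmul]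
      rfl
    | add x y hx hy =>
      rw [map_add, map_add, hx, hy, tensorRightCoaction_add, add_tmul]
      abel
  rw [h, hx, sub_self, map_zero]

variable (hT) in
/-- The map `a ↦ ϱ(a) - e ⊗ a` for the left coaction `ϱ`, whose kernel consists of the
coinvariants. -/
noncomputable def leftDefect : A →ₗ[Tᵐᵒᵖ] C ⊠[R] A :=
  leftCoactionT hT -
    { toFun := fun a => tmul R e a
      map_add' := tmul_add e
      map_smul' := fun _ _ => rfl }

variable (hT) in
/-- The map `a ↦ ϱ(a) - a ⊗ e` for the right coaction `ϱ`, whose kernel consists of the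
coinvariants. -/
def rightDefect : A →ₗ[T] A ⊠[R] C :=
  rightCoactionT hT -
    { toFun := fun a => tmul R a e
      map_add' := fun a b => add_tmul a b e
      map_smul' := fun _ _ => rfl }

theorem leftDefect_apply (a : A) : leftDefect hT a = E.leftCoaction e a - tmul R e a := rfl

theorem rightDefect_apply (a : A) : rightDefect hT a = E.rightCoaction e a - tmul R a e := rfl

variable (hj : ∀ a, E.IsCoinvariant e a ↔ ∃ b, j b = a)
include hj

theorem exists_eq_of_leftDefect_eq_zero (a : A) (ha : leftDefect hT a = 0) : ∃ b, j b = a :=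
  (hj a).1 (E.isCoinvariant_iff_leftCoaction.2 (sub_eq_zero.1 ha))

theorem exists_eq_of_rightDefect_eq_zero (a : A) (ha : rightDefect hT a = 0) : ∃ b, j b = a :=
  (hj a).1 (sub_eq_zero.1 ha)

/-- If `A` is left flat over `T`, then left coinvariants of `A ⊗_T A` come from `B ⊗_T A`. -/
theorem exists_map_eq_of_tensorLeftCoaction (hA : IsFlatLeft T A) (x : A ⊠[T] A)
    (hx : tensorLeftCoaction hT x = tmul R e x) :
    ∃ y : B ⊠[T] A, map j.right (LinearMap.id : A →ₗ[T] A) y = x :=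
  hA.exists_map_eq j.right (leftDefect hT) (exists_eq_of_leftDefect_eq_zero hj) x
    (map_leftCoactionT_sub hT x hx _ leftDefect_apply)

/-- If `A` is right flat over `T`, then right coinvariants of `A ⊗_T A` come from `A ⊗_T B`. -/
theorem exists_map_eq_of_tensorRightCoaction (hA : IsFlatRight T A) (x : A ⊠[T] A)
    (hx : tensorRightCoaction hT x = tmul R x e) :
    ∃ y : A ⊠[T] B, map (LinearMap.id : A →ₗ[Tᵐᵒᵖ] A) j.left y = x :=
  hA.exists_map_eq j.left (rightDefect hT) (exists_eq_of_rightDefect_eq_zero hj) x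
    (map_rightCoactionT_sub hT x hx _ rightDefect_apply)

end Coinvariants

/-! ### Locating ℓ(e) in B ⊗_T B and constructing the colinear retraction. -/

section Main

variable {R : Type*} {A C B T : Type u} [Ring R] [Ring A] [Module R A] [Module Rᵐᵒᵖ A] [RRing R A]
  [AddCommGroup C] [Module R C] [Module Rᵐᵒᵖ C] [SMulCommClass R Rᵐᵒᵖ C] [Coring R C]
  {E : BijEntwining R A C} {e : C} [Ring T] [Module T A] [Module Tᵐᵒᵖ A] [RRing T A]
  [AddCommGroup B] [Module T B] [Module Tᵐᵒᵖ B]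
  {hT : ∀ t : T, E.IsCoinvariant e (RRing.unit t : A)} {ℓ : BimodHom R R C (A ⊠[T] A)}
  {j : BimodHom T T B A}

/-- A ⊗_T A is flat since A is, and a ⊗ c ↦ a ℓ(c) embeds A ⊗_R C in it with the lifted canonical
map as retraction. -/
theorem isFlatLeft_tensor_coring (hℓ : IsStrongConnection hT ℓ) (hA : IsFlatLeft T A) :
    IsFlatLeft T (A ⊠[R] C) :=
  (hA.tensor hA).of_retract ((translationLeft ℓ).restrictScalars T)
    ((liftedCanLeft hT).restrictScalars T) hℓ.liftedCanLeft_translationLeft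

theorem isFlatRight_coring_tensor (hℓ : IsStrongConnection hT ℓ) (hA : IsFlatRight T A) :
    IsFlatRight T (C ⊠[R] A) :=
  (hA.tensor hA).of_retract ((translationRight ℓ).restrictScalars Tᵐᵒᵖ)
    ((liftedCanRight hT).restrictScalars Tᵐᵒᵖ) hℓ.liftedCanRight_translationRight

/-- The value `ℓ(e)` of a strong connection at a grouplike element comes from `B ⊗_T B`. -/
theorem exists_map_eq_grouplike_left (hℓ : IsStrongConnection hT ℓ) (he : IsGrouplike R e)
    (hj : ∀ a, E.IsCoinvariant e a ↔ ∃ b, j b = a) (hji : Function.Injective j)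
    (hA : IsFlatLeft T A) (hB : IsFlatRight T B) :
    ∃ z : B ⊠[T] B, map j.right j.left z = ℓ e := by
  obtain ⟨y, hy⟩ := exists_map_eq_of_tensorLeftCoaction (hT := hT) hj hA (ℓ e) (by
    rw [hℓ.left_colinear, he.comul_eq]; rfl)
  have hd := map_rightCoactionT_sub hT (ℓ e) (by rw [hℓ.right_colinear, he.comul_eq]; rfl)
    (rightDefect hT) rightDefect_apply
  obtain ⟨z, hz⟩ := hB.exists_map_eq j.left (rightDefect hT)
    (exists_eq_of_rightDefect_eq_zero hj) y (by
      -- Right coinvariance is known for ℓ(e), not for its lift y. Flatness of A ⊗_R C makes B ⊗_T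
      -- (A ⊗_R C) → A ⊗_T (A ⊗_R C) injective, which transfers it to y.
      refine isFlatLeft_tensor_coring hℓ hA _ _ j.right hji ?_
      rw [map_zero, ← hd, ← hy, map_map, map_map]
      rfl)
  exact ⟨z, by rw [← hy, ← hz, map_map]; rfl⟩

/-- The two lifts occur in the opposite order: right coinvariance first gives A ⊗_T B, then left
coinvariance is tested using right flatness of C ⊗_R A. -/
theorem exists_map_eq_grouplike_right (hℓ : IsStrongConnection hT ℓ) (he : IsGrouplike R e)
    (hj : ∀ a, E.IsCoinvariant e a ↔ ∃ b, j b = a) (hji : Function.Injective j)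
    (hA : IsFlatRight T A) (hB : IsFlatLeft T B) :
    ∃ z : B ⊠[T] B, map j.right j.left z = ℓ e := by
  obtain ⟨y, hy⟩ := exists_map_eq_of_tensorRightCoaction (hT := hT) hj hA (ℓ e) (by
    rw [hℓ.right_colinear, he.comul_eq]; rfl)
  have hd := map_leftCoactionT_sub hT (ℓ e) (by rw [hℓ.left_colinear, he.comul_eq]; rfl)
    (leftDefect hT) leftDefect_apply
  obtain ⟨z, hz⟩ := hB.exists_map_eq j.right (leftDefect hT)
    (exists_eq_of_leftDefect_eq_zero hj) y (by
      refine isFlatRight_coring_tensor hℓ hA _ _ j.left hji ?_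
      rw [map_zero, ← hd, ← hy, map_map, map_map]
      rfl)
  exact ⟨z, by rw [← hy, ← hz, map_map]; rfl⟩

variable (T) in
/-- The map `x ⊗ y ↦ x φ(y)`. -/
def mulMapLeft (φ : A →ₗ[T] A) : A ⊠[T] A →ₗ[A] A :=
  actLeft T A A ∘ₗ mapLeft LinearMap.id (fun _ _ => rfl) φ

variable (T) in
/-- The map `x ⊗ y ↦ φ(x) y`. -/
def mulMapRight (φ : A →ₗ[Tᵐᵒᵖ] A) : A ⊠[T] A →ₗ[Aᵐᵒᵖ] A :=
  actRight T A A ∘ₗ mapRight φ LinearMap.id (fun _ _ => rfl)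

theorem mulMapLeft_tmul (φ : A →ₗ[T] A) (x y : A) : mulMapLeft T φ (tmul T x y) = x * φ y := rfl

theorem mulMapRight_tmul (φ : A →ₗ[Tᵐᵒᵖ] A) (x y : A) :
    mulMapRight T φ (tmul T x y) = φ x * y := rfl

theorem mulMapLeft_eq (φ : A →ₗ[T] A) (z : A ⊠[T] A) :
    mulMapLeft T φ z = mulHom T A (map LinearMap.id φ z) := rfl

theorem mulMapRight_eq (φ : A →ₗ[Tᵐᵒᵖ] A) (z : A ⊠[T] A) :
    mulMapRight T φ z = mulHom T A (map φ LinearMap.id z) :=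
  tensor_hom_ext (f := (mulMapRight T φ).toAddMonoidHom)
    (g := (mulHom T A).toAddMonoidHom.comp (map φ LinearMap.id)) (fun _ _ => rfl) z

variable (hT) in
-- As φ(y) is coinvariant, ϱ(x φ(y)) = ϱ(x) φ(y), so the coaction sees only the first tensor factor.
theorem leftCoaction_mulMapLeft (φ : A →ₗ[T] A) (hφ : ∀ a, E.IsCoinvariant e (φ a))
    (z : A ⊠[T] A) : E.leftCoaction e (mulMapLeft T φ z) =
      map LinearMap.id ((mulMapLeft T φ).restrictScalars R) (tensorLeftCoaction hT z) := by
  induction z using tensor_induction with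
  | zero => simp [tensorLeftCoaction_zero]
  | pure x y =>
    rw [mulMapLeft_tmul, (hφ y).leftCoaction_mul, tensorLeftCoaction, map_tmul,
      leftCoactionT_apply]
    generalize E.leftCoaction e x = w
    induction w using tensor_induction with
    | zero => simp
    | pure c a => rfl
    | add v w hv hw => simp only [map_add, add_tmul, smul_add, hv, hw]
  | add x y hx hy => simp only [map_add, tensorLeftCoaction_add, hx, hy]

variable (hT) in
theorem rightCoaction_mulMapRight (φ : A →ₗ[Tᵐᵒᵖ] A) (hφ : ∀ a, E.IsCoinvariant e (φ a))
    (z : A ⊠[T] A) : E.rightCoaction e (mulMapRight T φ z) =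
      map ((mulMapRight T φ).restrictScalars Rᵐᵒᵖ) LinearMap.id (tensorRightCoaction hT z) := by
  induction z using tensor_induction with
  | zero => simp [tensorRightCoaction_zero]
  | pure x y =>
    rw [mulMapRight_tmul, (hφ x).rightCoaction_mul, tensorRightCoaction, map_tmul,
      rightCoactionT_apply]
    generalize E.rightCoaction e y = w
    induction w using tensor_induction with
    | zero => simp
    | pure a c => rfl
    | add v w hv hw => simp only [map_add, tmul_add, smul_add, hv, hw]
  | add x y hx hy => simp only [map_add, tensorRightCoaction_add, hx, hy]

theorem IsStrongConnection.isRelInjectiveLeft (hℓ : IsStrongConnection hT ℓ)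
    (he : IsGrouplike R e) (hj : ∀ a, E.IsCoinvariant e a ↔ ∃ b, j b = a)
    (hA : IsFlatLeft T A) (hB : IsFlatRight T B) (f : A →ₗ[T] B) (hf : ∀ b, f (j b) = b) :
    IsRelInjectiveLeft.{v} (E.leftCoaction e) := by
  have hji : Function.Injective j := Function.LeftInverse.injective hf
  obtain ⟨z, hz⟩ := exists_map_eq_grouplike_left hℓ he hj hji hA hB
  have hjb : ∀ b, E.IsCoinvariant e (j b) := fun b => (hj _).2 ⟨b, rfl⟩
  -- The left `B`-linear retraction `φ` of the inclusion of the coinvariants.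
  let φ : A →ₗ[T] A := (mulMapLeft T (j.left ∘ₗ f)).restrictScalars T ∘ₗ
    (translationLeft ℓ).restrictScalars T ∘ₗ rightCoactionT hT
  have hφ_apply : ∀ a, φ a =
      mulMapLeft T (j.left ∘ₗ f) (entwinedTranslationLeft E ℓ (tmul R e a)) := fun _ => rfl
  have hφ : ∀ a, E.IsCoinvariant e (φ a) := by
    intro a
    -- The image of e ⊗ a under a left colinear map is left coinvariant, hence comes from B ⊗_T A;
    -- there x ⊗ y ↦ x f(y) multiplies two elements of B.
    obtain ⟨y, hy⟩ := exists_map_eq_of_tensorLeftCoaction (hT := hT) hj hA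
      (entwinedTranslationLeft E ℓ (tmul R e a)) (by
        rw [hℓ.tensorLeftCoaction_entwinedTranslationLeft, map_tmul, BimodHom.right_apply,
          he.comul_eq]
        rfl)
    rw [hφ_apply, ← hy, mulMapLeft_eq, map_map]
    exact isCoinvariant_mulHom_map _ _ hjb (fun _ => hjb _) y
  -- On B ⊗_T B a map g fixing B has no effect, which leaves the product of ℓ(e).
  have hmul : ∀ g : A →ₗ[T] A, (∀ b, g (j b) = j b) → mulMapLeft T g (ℓ e) = 1 := by
    intro g hg
    rw [← hℓ.mulHom_grouplike he, mulMapLeft_eq, ← hz, map_map,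
      show g ∘ₗ j.left = j.left from LinearMap.ext hg, LinearMap.id_comp]
  have hφj : ∀ b, φ (j b) = j b := by
    intro b
    change mulMapLeft T (j.left ∘ₗ f) (translationLeft ℓ (E.rightCoaction e (j b))) = j b
    rw [hjb b, translationLeft_tmul, map_smul, hmul _ (fun b => congrArg j (hf b)), smul_eq_mul,
      mul_one]
  -- From here on only three properties of φ matter: `T`-linearity, coinvariant values, and φ(b) = b
  -- on B. The composite j ∘ f shares them.
  refine (E.isLeftComodule_leftCoaction he).isRelInjectiveLeft
    ((mulMapLeft T φ).restrictScalars R ∘ₗ entwinedTranslationLeft E ℓ) (fun a => ?_)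
    (fun x => ?_)
  · change mulMapLeft T φ (translationLeft ℓ (E.ψ (E.psiInv (tmul R a e)))) = a
    rw [psi_psiInv, translationLeft_tmul, map_smul, hmul φ hφj, smul_eq_mul, mul_one]
  · refine (leftCoaction_mulMapLeft hT φ hφ _).trans ?_
    rw [hℓ.tensorLeftCoaction_entwinedTranslationLeft, map_map]
    rfl

theorem IsStrongConnection.isRelInjectiveRight (hℓ : IsStrongConnection hT ℓ)
    (he : IsGrouplike R e) (hj : ∀ a, E.IsCoinvariant e a ↔ ∃ b, j b = a)
    (hA : IsFlatRight T A) (hB : IsFlatLeft T B) (f : A →ₗ[Tᵐᵒᵖ] B) (hf : ∀ b, f (j b) = b) :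
    IsRelInjectiveRight.{v} (E.rightCoaction e) := by
  have hji : Function.Injective j := Function.LeftInverse.injective hf
  obtain ⟨z, hz⟩ := exists_map_eq_grouplike_right hℓ he hj hji hA hB
  have hjb : ∀ b, E.IsCoinvariant e (j b) := fun b => (hj _).2 ⟨b, rfl⟩
  -- The right `B`-linear retraction `φ` of the inclusion of the coinvariants.
  let φ : A →ₗ[Tᵐᵒᵖ] A := (mulMapRight T (j.right ∘ₗ f)).restrictScalars Tᵐᵒᵖ ∘ₗ
    (translationRight ℓ).restrictScalars Tᵐᵒᵖ ∘ₗ leftCoactionT hT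
  have hφ_apply : ∀ a, φ a =
      mulMapRight T (j.right ∘ₗ f) (entwinedTranslationRight E ℓ (tmul R a e)) := fun _ => rfl
  have hφ : ∀ a, E.IsCoinvariant e (φ a) := by
    intro a
    obtain ⟨y, hy⟩ := exists_map_eq_of_tensorRightCoaction (hT := hT) hj hA
      (entwinedTranslationRight E ℓ (tmul R a e)) (by
        rw [hℓ.tensorRightCoaction_entwinedTranslationRight, map_tmul, BimodHom.left_apply,
          he.comul_eq]
        rfl)
    rw [hφ_apply, ← hy, mulMapRight_eq, map_map]
    exact isCoinvariant_mulHom_map _ _ (fun _ => hjb _) hjb y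
  have hmul : ∀ g : A →ₗ[Tᵐᵒᵖ] A, (∀ b, g (j b) = j b) → mulMapRight T g (ℓ e) = 1 := by
    intro g hg
    rw [← hℓ.mulHom_grouplike he, mulMapRight_eq, ← hz, map_map,
      show g ∘ₗ j.right = j.right from LinearMap.ext hg, LinearMap.id_comp]
  have hφj : ∀ b, φ (j b) = j b := by
    intro b
    change mulMapRight T (j.right ∘ₗ f) (translationRight ℓ (E.leftCoaction e (j b))) = j b
    -- In this version φ is built on the left coaction, so coinvariance of b is needed in the form
    -- ψ⁻¹(b ⊗ e) = e ⊗ b.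
    rw [E.isCoinvariant_iff_leftCoaction.1 (hjb b), translationRight_tmul, map_smul,
      hmul _ (fun b => congrArg j (hf b)), op_smul_eq_mul, one_mul]
  refine (E.isRightComodule_rightCoaction he).isRelInjectiveRight
    ((mulMapRight T φ).restrictScalars Rᵐᵒᵖ ∘ₗ entwinedTranslationRight E ℓ) (fun a => ?_)
    (fun x => ?_)
  · change mulMapRight T φ (translationRight ℓ (E.psiInv (E.ψ (tmul R e a)))) = a
    rw [psiInv_psi, translationRight_tmul, map_smul, hmul φ hφj, op_smul_eq_mul, one_mul]
  · refine (rightCoaction_mulMapRight hT φ hφ _).trans ?_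
    rw [hℓ.tensorRightCoaction_entwinedTranslationRight, map_map]
    rfl

end Main

/-! ### Specialization to the subalgebra of coinvariants. -/

section Inclusion

variable {k R : Type*} {A C : Type*} [CommRing k] [Ring R] [Algebra k R]
    [Ring A] [Algebra k A] [Module R A] [Module Rᵐᵒᵖ A] [IsScalarTower k R A] [RRing R A]
    [AddCommGroup C] [Module k C] [Module R C] [Module Rᵐᵒᵖ C] [SMulCommClass R Rᵐᵒᵖ C]
    [IsScalarTower k R C] [IsScalarTower k Rᵐᵒᵖ C] [Coring R C]
    (E : BijEntwining R A C) (e : C)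

/-- The inclusion of the coinvariants as a bimodule map over a subalgebra. -/
def coinvariantsInclusion (T : Subalgebra k (E.coinvariants e k)) :
    BimodHom T T (E.coinvariants e k) A where
  toAddMonoidHom := (E.coinvariants e k).val.toRingHom.toAddMonoidHom
  map_smul' _ _ := rfl
  map_op_smul' _ _ := rfl

end Inclusion

end BijEntwining
end Entw

theorem corollary4 {k R : Type*} {A C : Type u} [CommRing k] [Ring R] [Algebra k R]
    [Ring A] [Algebra k A] [Module R A] [Module Rᵐᵒᵖ A] [IsScalarTower k R A] [Entw.RRing R A]
    [AddCommGroup C] [Module k C] [Module R C] [Module Rᵐᵒᵖ C] [SMulCommClass R Rᵐᵒᵖ C]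
    [IsScalarTower k R C] [IsScalarTower k Rᵐᵒᵖ C] [Entw.Coring R C]
    (E : Entw.BijEntwining R A C) (e : C) (he : Entw.IsGrouplike R e)
    (T : Subalgebra k (E.coinvariants e k)) (hT : E.HasStrongConnection e T) :
    (Entw.IsFlatLeft T A → Entw.IsFlatRight T (E.coinvariants e k) →
      (∃ f : A →ₗ[T] E.coinvariants e k, ∀ b : E.coinvariants e k, f b = b) →
      Entw.IsRelInjectiveLeft.{v} (E.leftCoaction e)) ∧
    (Entw.IsFlatRight T A → Entw.IsFlatLeft T (E.coinvariants e k) →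
      (∃ f : A →ₗ[Tᵐᵒᵖ] E.coinvariants e k, ∀ b : E.coinvariants e k, f b = b) →
      Entw.IsRelInjectiveRight.{v} (E.rightCoaction e)) := by
  obtain ⟨ℓ, hℓ⟩ := hT
  have hj : ∀ a, E.IsCoinvariant e a ↔ ∃ b, E.coinvariantsInclusion e T b = a :=
    fun a => ⟨fun ha => ⟨⟨a, ha⟩, rfl⟩, fun ⟨b, hb⟩ => hb ▸ b.2⟩
  exact ⟨fun hA hB ⟨f, hf⟩ => hℓ.isRelInjectiveLeft he hj hA hB f hf,
    fun hA hB ⟨f, hf⟩ => hℓ.isRelInjectiveRight he hj hA hB f hf⟩
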